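/- \textbf{Setting.} There are $L$ groups of sensors; group $l$ consists of $N_l\ge 1$ sensors, indexed $(k,l)$ with $1\le k\le N_l$, and $N=\sum_{l=1}^L N_l$. For a change time $\nu\in\{0,1,2,\dots\}\cup\{\infty\}$, let $P_\nu$ (with expectation $E_\nu$) be the law under which all observations $X_t^{k,l}$, $t\ge 1$, are independent, with $X_t^{k,l}\sim f_l$ for $t\le\nu$ and $X_t^{k,l}\sim g_l$ for $t>\nu$. For each $l$ the probability measures $f_l,g_l$ are mutually absolutely continuous, the Kullback--Leibler divergence $\mathcal I_l=D(g_l\|f_l)$ is finite and positive, and the log-likelihood ratio $Z_t^{k,l}=\log\frac{dg_l}{df_l}(X_t^{k,l})$ has finite post-change variance $E_0[(Z_t^{k,l}-\mathcal I_l)^2]<\infty$. Let $\mathcal F_t$ be the $\sigma$-algebra generated by all $X_s^{k,l}$ with $1\le s\le t$. For an $(\mathcal F_t)$-stopping time $\rho$ put $$\mathrm{ARL}(\rho)=E_\infty[\rho],\qquad \mathrm{EDD}(\rho)=\sup_{\nu\ge 0}\operatorname{ess\,sup}E_\nu\big[(\rho-\nu)^+\mid\mathcal F_\nu\big].$$ The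 local CUSUM statistics are $W_0^{k,l}=0$, $W_t^{k,l}=\max\{0,W_{t-1}^{k,l}\}+Z_t^{k,l}$. For a threshold vector $\mathbf h=(h_1,\dots,h_L)$, a set $\mathcal D$ of sensors and $M\ge 1$, the $M$-th alarm rule within $\mathcal D$ is $$\tilde\rho^{(M)}(\mathbf h,\mathcal D)=\inf\Big\{t:\ \big|\{(k,l)\in\mathcal D:\ \max_{0\le s\le t}W_s^{k,l}>h_l\}\big|\ge M\Big\},$$ and the anonymous $M$-th alarm rule $\rho^{(M)}(\mathbf h)$ is the same rule with $\mathcal D$ the set of all sensors. Thresholds are chosen proportional to the divergences: for $h\in\mathbb R$ write $\mathbf h=\mathbf h(h)=(\mathcal I_1h,\dots,\mathcal I_Lh)$. \textbf{Statement.} Suppose that there is a unique most informative group $\mathcal G_{l^*}$, that is, $\mathcal I_l<\mathcal I_{l^*}$ for all $l\ne l^*$, and that $N_{l^*}<N/2$. Then there is a $\gamma_0$ such that for every $\gamma\ge\gamma_0$ the rule that accepts the first alarm from $\mathcal G_{l^*}$ achieves a better trade-off between $\mathrm{ARL}$ and $\mathrm{EDD}$ than every anonymous $M$-th alarm rule: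 \begin{enumerate} \item there is an $h'\in\mathbb R$ with $\mathrm{ARL}\big(\tilde\rho^{(1)}(\mathbf h(h'),\mathcal G_{l^*})\big)>\gamma$ such that, for all $M\in\{1,\dots,N\}$ and all $h\in\mathbb R$ with $\mathrm{ARL}\big(\rho^{(M)}(\mathbf h(h))\big)\ge\gamma$, $$\mathrm{EDD}\big(\tilde\rho^{(1)}(\mathbf h(h'),\mathcal G_{l^*})\big)<\mathrm{EDD}\big(\rho^{(M)}(\mathbf h(h))\big);$$ \item for all $M\in\{1,\dots,N\}$ and all $h,h'\in\mathbb R$ with $\mathrm{ARL}\big(\tilde\rho^{(1)}(\mathbf h(h'),\mathcal G_{l^*})\big)=\gamma=\mathrm{ARL}\big(\rho^{(M)}(\mathbf h(h))\big)$, the same strict inequality between the $\mathrm{EDD}$s holds. \end{enumerate} -/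

import Mathlib

open MeasureTheory Filter
open scoped ENNReal

namespace HetQCD

noncomputable section

variable {L : ℕ} {𝒳 : Fin L → Type*} [∀ l, MeasurableSpace (𝒳 l)]

/-- The sensors: the sensor `k` of group `l` is the pair `⟨l, k⟩` with `k < N l`. -/
abbrev Sensor (N : Fin L → ℕ) : Type := Σ l : Fin L, Fin (N l)

/-- The space of all observations of all sensors: `ω (i, t)` is the observation of sensor `i` at
time `t`. The observation times are `t = 1, 2, …`; the coordinate at `t = 0` is a dummy that is
used by no rule and by no `σ`-algebra below. -/
abbrev Obs (𝒳 : Fin L → Type*) (N : Fin L → ℕ) : Type _ :=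
  ∀ p : Sensor N × ℕ, 𝒳 p.1.1

/-- The law `P_ν` of all observations when the change happens at time `ν` (`ν = ⊤` means that there
is no change): independent observations, a sensor of group `l` having the law `f l` at times
`t ≤ ν` and `g l` at times `t > ν`. -/
def law (N : Fin L → ℕ) (f g : ∀ l, Measure (𝒳 l)) (ν : ℕ∞) : Measure (Obs 𝒳 N) :=
  Measure.infinitePi fun p : Sensor N × ℕ => if (p.2 : ℕ∞) ≤ ν then f p.1.1 else g p.1.1

/-- The filtration `F_t = σ(X_s^i ; 1 ≤ s ≤ t, i a sensor)`. -/
def observed (𝒳 : Fin L → Type*) [∀ l, MeasurableSpace (𝒳 l)] (N : Fin L → ℕ) :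
    Filtration ℕ (inferInstance : MeasurableSpace (Obs 𝒳 N)) where
  seq t := ⨆ (i : Sensor N) (s ∈ Set.Icc 1 t),
    MeasurableSpace.comap (fun ω : Obs 𝒳 N => ω (i, s)) inferInstance
  mono' _ _ hab := iSup_mono fun _ =>
    biSup_mono fun _ hs => ⟨hs.1, hs.2.trans hab⟩
  le' _ := iSup_le fun i => iSup₂_le fun s _ =>
    (measurable_pi_apply ((i, s) : Sensor N × ℕ)).comap_le

/-- The Kullback-Leibler divergence `I_l = D(g_l ‖ f_l)`, as a real number
(`0` if it is infinite). -/
def KL (f g : ∀ l, Measure (𝒳 l)) (l : Fin L) : ℝ :=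
  (InformationTheory.klDiv (g l) (f l)).toReal

/-- The local CUSUM statistic of sensor `i`: `W_0 = 0` and `W_t = max (0, W_{t-1}) + Z_t`, where
`Z_t = log (dg_l / df_l) (X_t)` is the log-likelihood ratio of the observation at time `t`. -/
def cusum {N : Fin L → ℕ} (f g : ∀ l, Measure (𝒳 l)) (i : Sensor N) (ω : Obs 𝒳 N) : ℕ → ℝ
  | 0 => 0
  | t + 1 => max 0 (cusum f g i ω t) + llr (g i.1) (f i.1) (ω (i, t + 1))

/-- The `M`-th alarm rule within a set `D` of sensors, with the threshold `h l` for group `l`: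
the first time by which at least `M` sensors of `D` have had their CUSUM statistic above their
threshold (not necessarily simultaneously); `⊤` if there is no such time. -/
def alarmWithin {N : Fin L → ℕ} (f g : ∀ l, Measure (𝒳 l)) (M : ℕ) (h : Fin L → ℝ)
    (D : Set (Sensor N)) (ω : Obs 𝒳 N) : ℕ∞ :=
  ⨅ (t : ℕ) (_ : M ≤ {i : Sensor N | i ∈ D ∧ ∃ s ≤ t, h i.1 < cusum f g i ω s}.ncard), (t : ℕ∞)

/-- The anonymous `M`-th alarm rule `ρ^(M)(h)`: all sensors take part. -/
def alarm (N : Fin L → ℕ) (f g : ∀ l, Measure (𝒳 l)) (M : ℕ) (h : Fin L → ℝ) :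
    Obs 𝒳 N → ℕ∞ :=
  alarmWithin f g M h Set.univ

/-- The set `G_l` of the sensors of group `l`. -/
def group (N : Fin L → ℕ) (l : Fin L) : Set (Sensor N) := {i | i.1 = l}

/-- The average run length to false alarm, `E_∞[ρ]`. -/
def ARL {N : Fin L → ℕ} (f g : ∀ l, Measure (𝒳 l)) (ρ : Obs 𝒳 N → ℕ∞) : ℝ≥0∞ :=
  ∫⁻ ω, (ρ ω : ℝ≥0∞) ∂(law N f g ⊤)

/-- Lorden's worst-case expected detection delay,
`sup_{ν ≥ 0} ess sup E_ν[(ρ - ν)⁺ | F_ν]`. -/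
def EDD {N : Fin L → ℕ} (f g : ∀ l, Measure (𝒳 l)) (ρ : Obs 𝒳 N → ℕ∞) : ℝ≥0∞ :=
  ⨆ ν : ℕ, essSup
    ((law N f g ν)⁻[fun ω => ((ρ ω - (ν : ℕ∞) : ℕ∞) : ℝ≥0∞) | observed 𝒳 N ν]) (law N f g ν)

end

end HetQCD

/-! Write `γ = exp (I_max * u)` and compare delays to second order, at scale `√u`. For the alarm
rules the worst case of `EDD` is a change at time `0`: restarting the CUSUMs at `0` can only delay
them, and the restarted rule is independent of the past. So `ARL_alarmWithin` and `EDD_alarmWithin`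
turn both criteria into expected alarm times of independent sensors with i.i.d. increments, whose
pre- and post-change laws `α`, `β` are related by `dβ/dα = exp x`.

The group rule needs only the threshold parameter `u + C`: a CUSUM crosses `b` by time `t` with
pre-change probability at most `exp (-b) * (t + 1)`, and a union bound over finitely many sensors
costs a constant (`exists_lt_expectedAlarm_group`). Its delay is at most that of one sensor, which a
Wald argument with truncated increments bounds by `u + o(√u)`; finite variance makes the truncation
error this small (`IsLLRLaw.eventually_tsum_not_crossed_le`).

For an anonymous rule, a single-sensor false alarm takes expected time at most `exp (I * (h +
o(√h)))` (`IsLLRLaw.eventually_tsum_not_crossed_le_exp`). If `M ≤ N - N_max`, the less informative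
sensors alone can raise the alarm, so the run length forces `h ≥ η * u` with a fixed `η > 1`, while
the delay is at least `(1 - ε) * h`: the rule loses to first order
(`eventually_lt_expectedAlarm_of_le`). If `M > N - N_max`, the run length still forces `h ≥ u -
o(√u)`. Post-change crossing times are asymptotically `h` plus `√h` times independent centred
normals (`IsLLRLaw.tendsto_measureReal_crossed`). As `N_max < N / 2`, the rule waits for an order
statistic on the upper side of the median, whose mean is positive by symmetry: the delay is at least
`h + c * √h` with `c > 0` (`exists_eventually_le_expectedAlarm`). This beats every `o(√u)` error, so
the rule loses to second order. -/

namespace HetQCD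

open ProbabilityTheory

/-! ### I.i.d. sequences, the CUSUM recursion and first-step bounds for its crossing times. -/

/-- The law of an i.i.d. sequence with marginal law `α`. -/
noncomputable def iid (α : Measure ℝ) : Measure (ℕ → ℝ) := Measure.infinitePi fun _ => α

/-- The sequence `x, z 0, z 1, …`. -/
def consSeq (x : ℝ) (z : ℕ → ℝ) : ℕ → ℝ
  | 0 => x
  | n + 1 => z n

@[simp] lemma consSeq_zero (x : ℝ) (z : ℕ → ℝ) : consSeq x z 0 = x := rfl

@[simp] lemma consSeq_succ (x : ℝ) (z : ℕ → ℝ) (n : ℕ) : consSeq x z (n + 1) = z n := rfl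

lemma measurable_consSeq : Measurable fun p : ℝ × (ℕ → ℝ) => consSeq p.1 p.2 := by
  rw [measurable_pi_iff]
  rintro (_ | n)
  · exact measurable_fst
  · exact (measurable_pi_apply n).comp measurable_snd

instance (α : Measure ℝ) [IsProbabilityMeasure α] : IsProbabilityMeasure (iid α) := by
  unfold iid; infer_instance

lemma map_consSeq_prod_iid (α : Measure ℝ) [IsProbabilityMeasure α] :
    (α.prod (iid α)).map (fun p : ℝ × (ℕ → ℝ) => consSeq p.1 p.2) = iid α := by
  refine Measure.eq_infinitePi _ fun s t ht => ?_
  classical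
  -- The cylinder is padded with `Set.univ` to an initial segment containing `0`, so that the first
  -- coordinate splits off.
  obtain ⟨n, hn⟩ := s.exists_nat_subset_range
  have hn' : s ⊆ Finset.range (n + 1) := hn.trans (Finset.range_mono n.le_succ)
  set t' : ℕ → Set ℝ := fun i => if i ∈ s then t i else Set.univ with ht'
  have mt' : ∀ i, MeasurableSet (t' i) := fun i => by
    simp only [ht']; split_ifs; exacts [ht i, .univ]
  have e1 : (s : Set ℕ).pi t = (Finset.range (n + 1) : Set ℕ).pi t' := by
    ext z
    simp only [Set.mem_pi, Finset.mem_coe, ht']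
    refine ⟨fun h i _ => ?_, fun h i hi => by simpa [hi] using h i (hn' hi)⟩
    split_ifs with hi
    exacts [h i hi, trivial]
  have e2 : ∏ i ∈ s, α (t i) = ∏ i ∈ Finset.range (n + 1), α (t' i) := by
    rw [← Finset.prod_subset hn' (f := fun i => α (t' i))]
    · exact Finset.prod_congr rfl fun i hi => by simp [ht', hi]
    · intro i _ hi; simp [ht', hi]
  rw [e1, e2, Measure.map_apply measurable_consSeq
    (MeasurableSet.pi (Finset.countable_toSet _) fun i _ => mt' i)]
  have e3 : (fun p : ℝ × (ℕ → ℝ) => consSeq p.1 p.2) ⁻¹' (Finset.range (n + 1) : Set ℕ).pi t' =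
      t' 0 ×ˢ (Finset.range n : Set ℕ).pi (fun i => t' (i + 1)) := by
    ext ⟨x, z⟩
    simp only [Set.mem_preimage, Set.mem_pi, Finset.mem_coe, Finset.mem_range, Set.mem_prod]
    constructor
    · exact fun h => ⟨h 0 (by omega), fun i hi => h (i + 1) (by omega)⟩
    · rintro ⟨h0, h⟩ (_ | i) hi
      exacts [h0, h i (by omega)]
  rw [e3, Measure.prod_prod, iid, Measure.infinitePi_pi _ (fun i _ => mt' _),
    Finset.prod_range_succ', mul_comm]

/-- First-step decomposition of an i.i.d. sequence. -/
lemma lintegral_iid (α : Measure ℝ) [IsProbabilityMeasure α] {F : (ℕ → ℝ) → ℝ≥0∞}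
    (hF : Measurable F) :
    ∫⁻ z, F z ∂iid α = ∫⁻ x, ∫⁻ z, F (consSeq x z) ∂iid α ∂α := by
  conv_lhs => rw [← map_consSeq_prod_iid α]
  rw [lintegral_map hF measurable_consSeq,
    lintegral_prod (fun p : ℝ × (ℕ → ℝ) => F (consSeq p.1 p.2))
      (hF.comp measurable_consSeq).aemeasurable]

lemma measure_iid (α : Measure ℝ) [IsProbabilityMeasure α] {A : Set (ℕ → ℝ)}
    (hA : MeasurableSet A) :
    iid α A = ∫⁻ x, iid α {z | consSeq x z ∈ A} ∂α := by
  rw [← lintegral_indicator_one hA, lintegral_iid α (measurable_one.indicator hA)]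
  refine lintegral_congr fun x => ?_
  have : MeasurableSet {z | consSeq x z ∈ A} :=
    (measurable_consSeq.comp (measurable_const.prodMk measurable_id)) hA
  rw [← lintegral_indicator_one this]
  rfl

/-- The CUSUM recursion driven by the increments `z`, started at `w`. -/
noncomputable def cusumFrom (w : ℝ) (z : ℕ → ℝ) : ℕ → ℝ
  | 0 => w
  | t + 1 => max 0 (cusumFrom w z t) + z t

@[simp] lemma cusumFrom_zero (w : ℝ) (z : ℕ → ℝ) : cusumFrom w z 0 = w := rfl

lemma cusumFrom_succ (w : ℝ) (z : ℕ → ℝ) (t : ℕ) :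
    cusumFrom w z (t + 1) = max 0 (cusumFrom w z t) + z t := rfl

lemma cusumFrom_add (w : ℝ) (z : ℕ → ℝ) (a t : ℕ) :
    cusumFrom w z (a + t) = cusumFrom (cusumFrom w z a) (fun n => z (a + n)) t := by
  induction t with
  | zero => rfl
  | succ t ih => rw [← add_assoc, cusumFrom_succ, cusumFrom_succ, ih]

lemma cusumFrom_consSeq_succ (w x : ℝ) (z : ℕ → ℝ) (t : ℕ) :
    cusumFrom w (consSeq x z) (t + 1) = cusumFrom (max 0 w + x) z t := by
  induction t with
  | zero => rfl
  | succ t ih => rw [cusumFrom_succ, ih, cusumFrom_succ]; rfl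

lemma measurable_cusumFrom (t : ℕ) :
    Measurable fun p : ℝ × (ℕ → ℝ) => cusumFrom p.1 p.2 t := by
  induction t with
  | zero => exact measurable_fst
  | succ t ih =>
    exact (measurable_const.max ih).add ((measurable_pi_apply t).comp measurable_snd)

/-- The CUSUM recursion started at `w` has exceeded `b` by time `t`. -/
def Crossed (w : ℝ) (z : ℕ → ℝ) (b : ℝ) (t : ℕ) : Prop := ∃ s ≤ t, b < cusumFrom w z s

lemma Crossed.mono_time {w b : ℝ} {z : ℕ → ℝ} {s t : ℕ} (h : Crossed w z b s) (hst : s ≤ t) :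
    Crossed w z b t := by
  obtain ⟨r, hr, h⟩ := h
  exact ⟨r, hr.trans hst, h⟩

lemma Crossed.anti_threshold {w b b' : ℝ} {z : ℕ → ℝ} {t : ℕ} (h : Crossed w z b t)
    (hb : b' ≤ b) : Crossed w z b' t := by
  obtain ⟨r, hr, h⟩ := h
  exact ⟨r, hr, hb.trans_lt h⟩

lemma crossed_of_lt {w b : ℝ} (h : b < w) (z : ℕ → ℝ) (t : ℕ) : Crossed w z b t :=
  ⟨0, t.zero_le, h⟩

lemma crossed_consSeq_succ {w b : ℝ} (h : w ≤ b) (x : ℝ) (z : ℕ → ℝ) (t : ℕ) :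
    Crossed w (consSeq x z) b (t + 1) ↔ Crossed (max 0 w + x) z b t := by
  constructor
  · rintro ⟨_ | s, hs, h'⟩
    · exact absurd h' h.not_gt
    · exact ⟨s, by omega, by rwa [cusumFrom_consSeq_succ] at h'⟩
  · rintro ⟨s, hs, h'⟩
    exact ⟨s + 1, by omega, by rwa [cusumFrom_consSeq_succ]⟩

lemma measurableSet_crossed (b : ℝ) (t : ℕ) :
    MeasurableSet {p : ℝ × (ℕ → ℝ) | Crossed p.1 p.2 b t} := by
  have : {p : ℝ × (ℕ → ℝ) | Crossed p.1 p.2 b t} =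
      ⋃ s ∈ Set.Iic t, {p | b < cusumFrom p.1 p.2 s} := by
    ext p; simp [Crossed]
  rw [this]
  exact MeasurableSet.biUnion (Set.to_countable _) fun s _ =>
    measurableSet_lt measurable_const (measurable_cusumFrom s)

lemma measurableSet_crossed_seq (w b : ℝ) (t : ℕ) :
    MeasurableSet {z : ℕ → ℝ | Crossed w z b t} :=
  (measurable_const.prodMk measurable_id) (measurableSet_crossed b t)

lemma measurableSet_not_crossed_seq (w b : ℝ) (t : ℕ) :
    MeasurableSet {z : ℕ → ℝ | ¬ Crossed w z b t} :=
  (measurableSet_crossed_seq w b t).compl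

/-- If the moment generating function at `1` is `1`, then the probability that the CUSUM
statistic exceeds `b` by time `t` grows at most linearly in `t`. -/
lemma measure_crossed_le {α : Measure ℝ} [IsProbabilityMeasure α]
    (hα : ∫⁻ x, ENNReal.ofReal (Real.exp x) ∂α = 1) (b : ℝ) (t : ℕ) (w : ℝ) :
    iid α {z | Crossed w z b t} ≤
      ENNReal.ofReal (Real.exp (-b)) * (t + ENNReal.ofReal (Real.exp w)) := by
  -- For a start above `b` the right-hand side is already at least `1`; only `w ≤ b` needs the
  -- recursion.
  have big : ∀ (t : ℕ) (w : ℝ), b < w →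
      1 ≤ ENNReal.ofReal (Real.exp (-b)) * (t + ENNReal.ofReal (Real.exp w)) := by
    intro t w h
    calc (1 : ℝ≥0∞) ≤ ENNReal.ofReal (Real.exp (-b) * Real.exp w) := by
          rw [← ENNReal.ofReal_one, ← Real.exp_add]
          exact ENNReal.ofReal_le_ofReal (Real.one_le_exp (by linarith))
      _ ≤ _ := by
          rw [ENNReal.ofReal_mul (Real.exp_pos _).le]
          gcongr
          exact le_add_self
  induction t generalizing w with
  | zero =>
    rcases lt_or_ge b w with h | h
    · exact prob_le_one.trans (big 0 w h)
    · have : {z : ℕ → ℝ | Crossed w z b 0} = ∅ := by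
        ext z
        simp only [Crossed, Set.mem_ofPred_eq, Set.mem_empty_iff_false, iff_false]
        rintro ⟨s, hs, h'⟩
        obtain rfl : s = 0 := by omega
        exact absurd h' h.not_gt
      simp [this]
  | succ t ih =>
    rcases lt_or_ge b w with h | h
    · exact prob_le_one.trans (big _ w h)
    rw [measure_iid α (measurableSet_crossed_seq w b (t + 1))]
    simp only [Set.mem_ofPred_eq, crossed_consSeq_succ h]
    -- One step preserves the form of the bound: the mean of `exp (max 0 w + x)` is `exp (max 0 w) ≤
    -- 1 + exp w`, and the `1` accounts for the increase of `t`.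
    calc ∫⁻ x, iid α {z | Crossed (max 0 w + x) z b t} ∂α
        ≤ ∫⁻ x, ENNReal.ofReal (Real.exp (-b)) * (t + ENNReal.ofReal (Real.exp (max 0 w)) *
            ENNReal.ofReal (Real.exp x)) ∂α := by
          refine lintegral_mono fun x => (ih _).trans_eq ?_
          rw [Real.exp_add, ENNReal.ofReal_mul (Real.exp_pos _).le]
      _ = ENNReal.ofReal (Real.exp (-b)) * (t + ENNReal.ofReal (Real.exp (max 0 w))) := by
          rw [lintegral_const_mul _ (by fun_prop), lintegral_add_left (by fun_prop),
            lintegral_const_mul _ (by fun_prop), hα]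
          simp
      _ ≤ _ := by
          rw [Nat.cast_succ, add_assoc]
          refine mul_le_mul_right (add_le_add_right ?_ _) _
          rw [← ENNReal.ofReal_one, ← ENNReal.ofReal_add zero_le_one (Real.exp_pos _).le]
          apply ENNReal.ofReal_le_ofReal
          rcases le_total 0 w with h0 | h0
          · rw [max_eq_right h0]; linarith
          · rw [max_eq_left h0, Real.exp_zero]; linarith [Real.exp_pos w]

/-- Bound on the expected time at which the CUSUM statistic exceeds `b`, when the increments
truncated at `K` have positive mean. -/
lemma sum_measure_not_crossed_le {β : Measure ℝ} [IsProbabilityMeasure β] {K b J : ℝ}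
    (hb : 0 ≤ b) (hint : Integrable (fun x => x) β)
    (hJ : ∫ x, min x K ∂β = J) (hJ0 : 0 < J) (n : ℕ) (w : ℝ) (hw : w ≤ b) :
    ∑ t ∈ Finset.range n, iid β {z | ¬ Crossed w z b t} ≤ ENNReal.ofReal ((b - w + K) / J) := by
  have hintK : Integrable (fun x => min x K) β := hint.inf (integrable_const K)
  induction n generalizing w with
  | zero => simp
  | succ n ih =>
    have hw' : max 0 w ≤ b := max_le hb hw
    rw [Finset.sum_range_succ']
    have e1 : ∀ t, iid β {z | ¬ Crossed w z b (t + 1)} =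
        ∫⁻ x, iid β {z | ¬ Crossed (max 0 w + x) z b t} ∂β := by
      intro t
      rw [measure_iid β (measurableSet_not_crossed_seq w b (t + 1))]
      simp only [Set.mem_ofPred_eq, crossed_consSeq_succ hw]
    simp only [e1]
    rw [← lintegral_finsetSum]
    swap
    · intro t _
      have : MeasurableSet {p : ℝ × (ℕ → ℝ) | ¬ Crossed (max 0 w + p.1) p.2 b t} :=
        ((measurable_const.add measurable_fst).prodMk measurable_snd)
          (measurableSet_crossed b t).compl
      exact measurable_measure_prodMk_left this
    -- Truncation caps the overshoot at `K`, so the argument on the right stays nonnegative and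
    -- `ofReal` may be integrated as a real function. Its mean then drops by `J / J = 1`, which pays
    -- for the time just spent.
    have hstep : ∀ x, ∑ t ∈ Finset.range n, iid β {z | ¬ Crossed (max 0 w + x) z b t} ≤
        ENNReal.ofReal ((b - max 0 w + K - min x K) / J) := by
      intro x
      rcases le_or_gt (max 0 w + x) b with h | h
      · refine (ih _ h).trans (ENNReal.ofReal_le_ofReal ?_)
        gcongr
        linarith [min_le_left x K]
      · have : ∀ t, {z | ¬ Crossed (max 0 w + x) z b t} = ∅ := by
          intro t; ext z; simp [crossed_of_lt h z t]
        simp [this]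
    calc ∫⁻ x, ∑ t ∈ Finset.range n, iid β {z | ¬ Crossed (max 0 w + x) z b t} ∂β
          + iid β {z | ¬ Crossed w z b 0}
        ≤ ∫⁻ x, ENNReal.ofReal ((b - max 0 w + K - min x K) / J) ∂β + 1 := by
          gcongr with x
          · exact hstep x
          · exact prob_le_one
      _ = ENNReal.ofReal ((b - max 0 w + K) / J) := by
          rw [← ofReal_integral_eq_lintegral_ofReal]
          · rw [integral_div, integral_sub (integrable_const _) hintK, hJ, ← ENNReal.ofReal_one,
              ← ENNReal.ofReal_add _ zero_le_one]
            · congr 1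
              simp
              field_simp
              ring
            · rw [← hJ, ← integral_sub (by fun_prop) hintK, hJ]
              refine div_nonneg (integral_nonneg fun x => ?_) hJ0.le
              simp only [Pi.zero_apply]
              linarith [min_le_right x K]
          · exact ((integrable_const _).sub hintK).div_const _
          · refine .of_forall fun x => div_nonneg ?_ hJ0.le
            linarith [min_le_right x K]
      _ ≤ _ := by
          apply ENNReal.ofReal_le_ofReal
          gcongr
          exact le_max_right _ _

lemma tsum_measure_not_crossed_le {β : Measure ℝ} [IsProbabilityMeasure β] {K b J : ℝ}
    (hb : 0 ≤ b) (hint : Integrable (fun x => x) β)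
    (hJ : ∫ x, min x K ∂β = J) (hJ0 : 0 < J) :
    ∑' t, iid β {z | ¬ Crossed 0 z b t} ≤ ENNReal.ofReal ((b + K) / J) := by
  refine ENNReal.tsum_le_of_sum_range_le fun n => ?_
  simpa using sum_measure_not_crossed_le hb hint hJ hJ0 n 0 hb

end HetQCD

/-! ### Change of measure, independent blocks, and comparison of the CUSUM with partial sums. -/

namespace HetQCD

open ProbabilityTheory

/-- `β` has the density `exp` with respect to `α`, as the laws of a log-likelihood ratio under
the two hypotheses do. -/
def IsExpTilt (α β : Measure ℝ) : Prop :=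
  β = α.withDensity fun x => ENNReal.ofReal (Real.exp x)

section IsExpTilt

variable {α β : Measure ℝ}

lemma IsExpTilt.lintegral_eq (h : IsExpTilt α β) {φ : ℝ → ℝ≥0∞} (hφ : Measurable φ) :
    ∫⁻ x, φ x ∂β = ∫⁻ x, ENNReal.ofReal (Real.exp x) * φ x ∂α := by
  rw [h, lintegral_withDensity_eq_lintegral_mul _ (by fun_prop) hφ]
  rfl

lemma IsExpTilt.lintegral_exp [IsProbabilityMeasure β] (h : IsExpTilt α β) :
    ∫⁻ x, ENNReal.ofReal (Real.exp x) ∂α = 1 := by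
  have := h.lintegral_eq (φ := fun _ => 1) measurable_const
  simpa using this.symm

lemma IsExpTilt.lintegral_exp_neg [IsProbabilityMeasure α] (h : IsExpTilt α β) :
    ∫⁻ x, ENNReal.ofReal (Real.exp (-x)) ∂β = 1 := by
  rw [h.lintegral_eq (by fun_prop)]
  simp [← ENNReal.ofReal_mul, (Real.exp_pos _).le, ← Real.exp_add]

variable [IsProbabilityMeasure α] [IsProbabilityMeasure β]

/-- Change of measure for the partial sums of an i.i.d. sequence. -/
lemma IsExpTilt.lintegral_sum (h : IsExpTilt α β) (n : ℕ) {φ : ℝ → ℝ≥0∞} (hφ : Measurable φ) :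
    ∫⁻ z, φ (∑ i ∈ Finset.range n, z i) ∂iid β =
      ∫⁻ z, ENNReal.ofReal (Real.exp (∑ i ∈ Finset.range n, z i)) *
        φ (∑ i ∈ Finset.range n, z i) ∂iid α := by
  induction n generalizing φ with
  | zero => simp
  | succ n ih =>
    rw [lintegral_iid β (by fun_prop), lintegral_iid α (by fun_prop)]
    simp only [Finset.sum_range_succ', consSeq_succ, consSeq_zero]
    -- Conditionally on the first term `x`, the induction hypothesis applies to the translate of `φ`
    -- by `x`.
    simp_rw [fun x => ih (φ := fun y => φ (y + x)) (by fun_prop)]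
    rw [h.lintegral_eq]
    · refine lintegral_congr fun x => ?_
      rw [← lintegral_const_mul _ (by fun_prop)]
      refine lintegral_congr fun z => ?_
      rw [Real.exp_add, ENNReal.ofReal_mul (Real.exp_pos _).le]
      ring
    · exact Measurable.lintegral_prod_right' (f := fun p : ℝ × (ℕ → ℝ) =>
        ENNReal.ofReal (Real.exp (∑ i ∈ Finset.range n, p.2 i)) *
          φ (∑ i ∈ Finset.range n, p.2 i + p.1)) (by fun_prop)

/-- Lower bound for the probability of a large partial sum, by change of measure. -/
lemma IsExpTilt.measure_lt_sum_ge (h : IsExpTilt α β) (n : ℕ) (b c : ℝ) :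
    ENNReal.ofReal (Real.exp (-c)) *
        iid β {z | ∑ i ∈ Finset.range n, z i ∈ Set.Ioc b c} ≤
      iid α {z | b < ∑ i ∈ Finset.range n, z i} := by
  have hm : Measurable fun z : ℕ → ℝ => ∑ i ∈ Finset.range n, z i := by fun_prop
  have e1 : iid β {z | ∑ i ∈ Finset.range n, z i ∈ Set.Ioc b c} =
      ∫⁻ z, (Set.Ioc b c).indicator 1 (∑ i ∈ Finset.range n, z i) ∂iid β := by
    rw [← lintegral_indicator_one (s := {z : ℕ → ℝ | ∑ i ∈ Finset.range n, z i ∈ Set.Ioc b c})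
      (hm measurableSet_Ioc)]
    rfl
  have e2 : iid α {z | b < ∑ i ∈ Finset.range n, z i} =
      ∫⁻ z, (Set.Ioi b).indicator 1 (∑ i ∈ Finset.range n, z i) ∂iid α := by
    rw [← lintegral_indicator_one (s := {z : ℕ → ℝ | b < ∑ i ∈ Finset.range n, z i})
      (hm measurableSet_Ioi)]
    rfl
  rw [e1, e2, h.lintegral_sum n (measurable_one.indicator measurableSet_Ioc),
    ← lintegral_const_mul]
  swap
  · have := (measurable_one (α := ℝ≥0∞)).indicator (measurableSet_Ioc (a := b) (b := c))
    fun_prop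
  refine lintegral_mono fun z => ?_
  by_cases hz : ∑ i ∈ Finset.range n, z i ∈ Set.Ioc b c
  · have hz' : ∑ i ∈ Finset.range n, z i ∈ Set.Ioi b := hz.1
    simp only [Set.indicator_of_mem hz, Set.indicator_of_mem hz', Pi.one_apply, mul_one]
    rw [← ENNReal.ofReal_mul (Real.exp_pos _).le, ← Real.exp_add, ← ENNReal.ofReal_one]
    apply ENNReal.ofReal_le_ofReal
    rw [Real.exp_le_one_iff]
    linarith [hz.2]
  · simp [Set.indicator_of_notMem hz]

end IsExpTilt

section Blocks

variable {α : Measure ℝ} [IsProbabilityMeasure α]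

/-- The first `n` terms of an i.i.d. sequence are independent of the later ones. -/
lemma measure_sum_le_inter_shift (n : ℕ) {B : Set (ℕ → ℝ)} (hB : MeasurableSet B) (b : ℝ) :
    iid α {z | ∑ i ∈ Finset.range n, z i ≤ b ∧ (fun k => z (n + k)) ∈ B} =
      iid α {z | ∑ i ∈ Finset.range n, z i ≤ b} * iid α B := by
  have hm : ∀ n, Measurable fun z : ℕ → ℝ => ∑ i ∈ Finset.range n, z i := fun n => by fun_prop
  have hs : ∀ n, Measurable fun (z : ℕ → ℝ) (k : ℕ) => z (n + k) := fun n => by fun_prop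
  induction n generalizing b with
  | zero => 
    have : {z : ℕ → ℝ | (fun i => z i) ∈ B} = B := rfl
    by_cases h : 0 ≤ b <;> simp [h, this]
  | succ n ih =>
    rw [measure_iid α (A := {z | ∑ i ∈ Finset.range (n + 1), z i ≤ b ∧
        (fun k => z (n + 1 + k)) ∈ B}) ((hm _ measurableSet_Iic).inter (hs _ hB)),
      measure_iid α (A := {z | ∑ i ∈ Finset.range (n + 1), z i ≤ b})
        (hm (n + 1) measurableSet_Iic), ← lintegral_mul_const]
    · refine lintegral_congr fun x => ?_
      have := ih (b - x)
      simp only [le_sub_iff_add_le] at this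
      convert this using 3
      · ext z
        simp only [Set.mem_ofPred_eq, Finset.sum_range_succ', consSeq_succ, consSeq_zero, Nat.add_right_comm n 1]
      · ext z
        simp only [Set.mem_ofPred_eq, Finset.sum_range_succ', consSeq_succ, consSeq_zero]
    · exact measurable_measure_prodMk_left
        (measurable_consSeq (hm (n + 1) measurableSet_Iic))

/-- The maximum with `0` only increases the running sum. Strictness of `k < s` matters: without an
intervening step the statistic may be negative. -/
lemma le_cusumFrom (w : ℝ) (z : ℕ → ℝ) {k s : ℕ} (hks : k < s) :
    ∑ i ∈ Finset.Ico k s, z i ≤ cusumFrom w z s := by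
  induction s, hks using Nat.le_induction with
  | base => simp [cusumFrom_succ]
  | succ s hs ih =>
    rw [Finset.sum_Ico_succ_top (by omega), cusumFrom_succ]
    gcongr
    exact ih.trans (le_max_right _ _)

/-- The set of sequences whose first `j` blocks of length `n` have sums at most `b`. -/
def blockSet (n : ℕ) (b : ℝ) (j : ℕ) : Set (ℕ → ℝ) :=
  {z | ∀ i < j, ∑ k ∈ Finset.range n, z (i * n + k) ≤ b}

lemma measurableSet_blockSet (n : ℕ) (b : ℝ) (j : ℕ) : MeasurableSet (blockSet n b j) := by
  have : blockSet n b j = ⋂ i ∈ Set.Iio j, {z | ∑ k ∈ Finset.range n, z (i * n + k) ≤ b} := by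
    ext z; simp [blockSet]
  rw [this]
  exact MeasurableSet.biInter (Set.to_countable _) fun i _ =>
    measurableSet_le (by fun_prop) measurable_const

lemma measure_blockSet (n : ℕ) (b : ℝ) (j : ℕ) :
    iid α (blockSet n b j) = iid α {z | ∑ i ∈ Finset.range n, z i ≤ b} ^ j := by
  induction j with
  | zero => simp [blockSet]
  | succ j ih =>
    rw [pow_succ', ← ih, ← measure_sum_le_inter_shift n (measurableSet_blockSet n b j)]
    congr 1
    ext z
    simp only [blockSet, Set.mem_ofPred_eq]
    constructor
    · intro h
      refine ⟨by simpa using h 0 (by omega), fun i hi => ?_⟩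
      refine (Finset.sum_congr rfl fun k _ => ?_).trans_le (h (i + 1) (by omega))
      congr 1; ring
    · rintro ⟨h0, h⟩ (_ | i) hi
      · simpa using h0
      · refine (Finset.sum_congr rfl fun k _ => ?_).trans_le (h i (by omega))
        congr 1; ring

/-- A block with sum above `b` would push the CUSUM above `b` at the end of the block. This replaces
the dependent crossing event by independent block events. -/
lemma mem_blockSet_of_not_crossed {n : ℕ} (hn : 0 < n) {b w : ℝ} {t : ℕ} {z : ℕ → ℝ}
    (h : ¬ Crossed w z b t) : z ∈ blockSet n b (t / n) := by
  intro i hi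
  by_contra! hlt
  have hle : (i + 1) * n ≤ t := (Nat.mul_le_mul_right n hi).trans (Nat.div_mul_le_self t n)
  refine h ⟨(i + 1) * n, hle, hlt.trans_le ?_⟩
  have := le_cusumFrom w z (k := i * n) (s := (i + 1) * n) (by rw [add_mul]; omega)
  rwa [Finset.sum_Ico_eq_sum_range, show (i + 1) * n - i * n = n by rw [add_mul]; omega] at this

/-- Geometric bound on the expected crossing time. -/
lemma tsum_measure_not_crossed_le_div {n : ℕ} (hn : 0 < n) (b w : ℝ) :
    ∑' t, iid α {z | ¬ Crossed w z b t} ≤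
      n / iid α {z | b < ∑ i ∈ Finset.range n, z i} := by
  set r := iid α {z | ∑ i ∈ Finset.range n, z i ≤ b} with hr
  have hp : iid α {z | b < ∑ i ∈ Finset.range n, z i} = 1 - r := by
    rw [hr, ← prob_compl_eq_one_sub (measurableSet_le (by fun_prop) measurable_const)]
    congr 1; ext z; simp
  have : NeZero n := ⟨hn.ne'⟩
  calc ∑' t, iid α {z | ¬ Crossed w z b t} ≤ ∑' t : ℕ, r ^ (t / n) := by
        refine ENNReal.tsum_le_tsum fun t => ?_
        rw [hr, ← measure_blockSet]
        exact measure_mono fun z hz => mem_blockSet_of_not_crossed hn hz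
    -- Division with remainder makes each power occur `n` times, leaving a geometric series.
    _ = ∑' p : ℕ × Fin n, r ^ p.1 := by
        rw [← (Nat.divModEquiv n).tsum_eq fun p : ℕ × Fin n => r ^ p.1]
        rfl
    _ = n / iid α {z | b < ∑ i ∈ Finset.range n, z i} := by
        rw [ENNReal.tsum_prod (f := fun (j : ℕ) (_ : Fin n) => r ^ j), hp]
        simp only [tsum_fintype, Finset.sum_const, Finset.card_univ, Fintype.card_fin,
          nsmul_eq_mul]
        rw [ENNReal.tsum_mul_left, ENNReal.tsum_geometric, ENNReal.div_eq_inv_mul, mul_comm]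

end Blocks

/-- A product of functions of integral one of the terms of an i.i.d. sequence has integral one. -/
lemma lintegral_prod_iid_eq_one {β : Measure ℝ} [IsProbabilityMeasure β] (n : ℕ)
    {φ : ℕ → ℝ → ℝ≥0∞} (hφ : ∀ j, Measurable (φ j)) (h : ∀ j, ∫⁻ x, φ j x ∂β = 1) :
    ∫⁻ z, ∏ j ∈ Finset.range n, φ j (z j) ∂iid β = 1 := by
  induction n generalizing φ with
  | zero => simp
  | succ n ih =>
    rw [lintegral_iid β (by fun_prop)]
    simp only [Finset.prod_range_succ', consSeq_succ, consSeq_zero]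
    simp_rw [fun x => lintegral_mul_const (μ := iid β) (φ 0 x)
      (f := fun z => ∏ j ∈ Finset.range n, φ (j + 1) (z j)) (by fun_prop),
      ih (fun j => hφ (j + 1)) (fun j => h (j + 1)), one_mul]
    exact h 0

section Upper

variable {α β : Measure ℝ} [IsProbabilityMeasure α] [IsProbabilityMeasure β]

/-- Markov's inequality for `exp (-∑ z j)`, whose post-change mean is exactly `1`; hence the bound
does not depend on `J`. -/
lemma IsExpTilt.measure_sum_le_neg_le (h : IsExpTilt α β) (t : ℕ) (J : Finset ℕ)
    (hJ : J ⊆ Finset.range t) (a : ℝ) :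
    iid β {z | ∑ j ∈ J, z j ≤ -a} ≤ ENNReal.ofReal (Real.exp (-a)) := by
  classical
  have h1 : ∫⁻ z, ENNReal.ofReal (Real.exp (-∑ j ∈ J, z j)) ∂iid β = 1 := by
    rw [← lintegral_prod_iid_eq_one (β := β) t
      (φ := fun j x => if j ∈ J then ENNReal.ofReal (Real.exp (-x)) else 1)
      (fun j => by split_ifs <;> fun_prop)
      (fun j => by split_ifs; exacts [h.lintegral_exp_neg, by simp])]
    refine lintegral_congr fun z => ?_
    rw [← Finset.sum_neg_distrib, Real.exp_sum,
      ENNReal.ofReal_prod_of_nonneg fun i _ => (Real.exp_pos _).le,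
      ← Finset.prod_filter, Finset.filter_mem_eq_inter, Finset.inter_eq_right.2 hJ]
  have h2 := meas_ge_le_lintegral_div (μ := iid β)
    (f := fun z => ENNReal.ofReal (Real.exp (-∑ j ∈ J, z j))) (by fun_prop)
    (ε := ENNReal.ofReal (Real.exp a)) (by simpa using Real.exp_pos a) ENNReal.ofReal_ne_top
  rw [h1, one_div, ← ENNReal.ofReal_inv_of_pos (Real.exp_pos a), ← Real.exp_neg] at h2
  refine (measure_mono fun z hz => ?_).trans h2
  refine ENNReal.ofReal_le_ofReal (Real.exp_le_exp.2 ?_)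
  have : ∑ j ∈ J, z j ≤ -a := hz
  linarith

/-- Unroll the recursion back to the last reset. When the final increment alone reaches `b`, the
hypothesis is applied at level `0`, to keep the level nonnegative. -/
lemma exists_lt_sum_of_lt_cusumFrom {z : ℕ → ℝ} {b : ℝ} (hb : 0 ≤ b) {s : ℕ}
    (h : b < cusumFrom 0 z s) : ∃ k ≤ s, b < ∑ i ∈ Finset.Ico k s, z i := by
  induction s generalizing b with
  | zero => exact absurd h hb.not_gt
  | succ s ih =>
    rw [cusumFrom_succ] at h
    rcases le_or_gt (cusumFrom 0 z s) 0 with h0 | h0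
    · rw [max_eq_left h0] at h
      exact ⟨s, s.le_succ, by simpa using h⟩
    · rw [max_eq_right h0.le] at h
      rcases lt_or_ge (z s) b with hz | hz
      · obtain ⟨k, hk, hlt⟩ := ih (b := b - z s) (by linarith) (by linarith)
        refine ⟨k, by omega, ?_⟩
        rw [Finset.sum_Ico_succ_top (by omega)]
        linarith
      · obtain ⟨k, hk, hlt⟩ := ih (b := 0) le_rfl h0
        refine ⟨k, by omega, ?_⟩
        rw [Finset.sum_Ico_succ_top (by omega)]
        linarith

/-- Comparison of the CUSUM statistic with the partial sums under the post-change law. -/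
lemma IsExpTilt.measure_crossed_le (h : IsExpTilt α β) {b : ℝ} (hb : 0 ≤ b) (a : ℝ) (t : ℕ) :
    iid β {z | Crossed 0 z b t} ≤ iid β {z | b - a < ∑ i ∈ Finset.range t, z i} +
      ENNReal.ofReal ((t + 1) ^ 2 * Real.exp (-a)) := by
  classical
  -- If a stretch `[k, s)` has sum above `b`, then either the full sum exceeds `b - a` or the terms
  -- outside the stretch sum to at most `-a`. The factor `(t + 1) ^ 2` counts the pairs `(k, s)`.
  set J : ℕ × ℕ → Finset ℕ := fun p => Finset.range t \ Finset.Ico p.1 p.2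
  have hsub : {z | Crossed 0 z b t} ⊆ {z | b - a < ∑ i ∈ Finset.range t, z i} ∪
      ⋃ p ∈ Finset.range (t + 1) ×ˢ Finset.range (t + 1), {z | ∑ j ∈ J p, z j ≤ -a} := by
    rintro z ⟨s, hs, hz⟩
    obtain ⟨k, hk, hlt⟩ := exists_lt_sum_of_lt_cusumFrom hb hz
    by_cases hz' : b - a < ∑ i ∈ Finset.range t, z i
    · exact Or.inl hz'
    refine Or.inr (Set.mem_biUnion (x := (k, s)) ?_ ?_)
    · simp; omega
    · have hI : Finset.Ico k s ⊆ Finset.range t := by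
        intro i hi
        simp only [Finset.mem_Ico, Finset.mem_range] at hi ⊢
        omega
      have := Finset.sum_sdiff hI (f := z)
      change ∑ j ∈ Finset.range t \ Finset.Ico k s, z j ≤ -a
      linarith
  refine (measure_mono hsub).trans ((measure_union_le _ _).trans ?_)
  gcongr
  refine (measure_biUnion_finset_le _ _).trans ?_
  refine (Finset.sum_le_card_nsmul _ _ _ fun p _ =>
    h.measure_sum_le_neg_le t (J p) Finset.sdiff_subset a).trans_eq ?_
  rw [Finset.card_product, Finset.card_range, nsmul_eq_mul, ENNReal.ofReal_mul (by positivity)]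
  congr 1
  rw [← Nat.cast_add_one, ← Nat.cast_pow, ENNReal.ofReal_natCast, sq]

end Upper

end HetQCD

/-! ### Gaussian tails, the central limit theorem and Chebyshev's inequality. -/

namespace HetQCD

open ProbabilityTheory Topology
open scoped NNReal

/-- The upper tail of the centered normal distribution of variance `v`. -/
noncomputable def gaussTail (v : ℝ≥0) (c : ℝ) : ℝ := (gaussianReal 0 v).real (Set.Ioi c)

section GaussTail

variable {v : ℝ≥0}

lemma gaussTail_eq (v : ℝ≥0) (c : ℝ) : gaussTail v c = 1 - cdf (gaussianReal 0 v) c := by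
  rw [cdf_eq_real, gaussTail, ← Set.compl_Iic, probReal_compl_eq_one_sub measurableSet_Iic]

lemma continuous_gaussTail (hv : v ≠ 0) : Continuous (gaussTail v) := by
  have h : Continuous (cdf (gaussianReal 0 v)) := by
    rw [continuous_iff_continuousAt]
    intro c
    rw [(monotone_cdf _).continuousAt_iff_leftLim_eq_rightLim, StieltjesFunction.rightLim_eq]
    have h1 := (cdf (gaussianReal 0 v)).measure_singleton c
    have := nullSingletonClass_gaussianReal (μ := 0) hv
    rw [measure_cdf, measure_singleton, eq_comm, ENNReal.ofReal_eq_zero, sub_nonpos] at h1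
    exact le_antisymm ((monotone_cdf _).leftLim_le le_rfl) h1
  exact (continuous_const.sub h).congr fun c => (gaussTail_eq v c).symm

lemma gaussTail_neg (hv : v ≠ 0) (c : ℝ) : gaussTail v (-c) = 1 - gaussTail v c := by
  have := nullSingletonClass_gaussianReal (μ := 0) hv
  rw [gaussTail, gaussTail, ← probReal_compl_eq_one_sub measurableSet_Ioi, Set.compl_Ioi]
  have h1 := gaussianReal_map_neg (μ := 0) (v := v)
  rw [neg_zero] at h1
  conv_lhs => rw [← h1]
  rw [map_measureReal_apply measurable_neg measurableSet_Ioi]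
  have : (fun x : ℝ => -x) ⁻¹' Set.Ioi (-c) = Set.Iio c := by ext; simp
  rw [this]
  exact measureReal_congr Iio_ae_eq_Iic

lemma gaussTail_pos (hv : v ≠ 0) (c : ℝ) : 0 < gaussTail v c := by
  refine (measureReal_nonneg).lt_of_ne' fun h => ?_
  rw [measureReal_eq_zero_iff] at h
  simpa using gaussianReal_absolutelyContinuous' 0 hv h

lemma gaussTail_lt_one (hv : v ≠ 0) (c : ℝ) : gaussTail v c < 1 := by
  have := gaussTail_pos hv (-c)
  rw [gaussTail_neg hv] at this
  linarith

lemma gaussTail_strictAnti (hv : v ≠ 0) : StrictAnti (gaussTail v) := by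
  intro c d hcd
  refine (measureReal_mono (Set.Ioi_subset_Ioi hcd.le)).lt_of_ne fun h => ?_
  have h1 : (gaussianReal 0 v).real (Set.Ioc c d) = 0 := by
    rw [← Set.Ioi_sdiff_Ioi, measureReal_sdiff (Set.Ioi_subset_Ioi hcd.le) measurableSet_Ioi, h,
      sub_self]
  rw [measureReal_eq_zero_iff] at h1
  have := gaussianReal_absolutelyContinuous' 0 hv h1
  simp at this
  linarith

end GaussTail

section CLT

variable {β : Measure ℝ} [IsProbabilityMeasure β]

lemma measurePreserving_eval_iid (k : ℕ) : MeasurePreserving (fun z : ℕ → ℝ => z k) (iid β) β :=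
  measurePreserving_eval_infinitePi (fun _ : ℕ => β) k

lemma iIndepFun_iid : iIndepFun (fun (k : ℕ) (z : ℕ → ℝ) => z k) (iid β) :=
  iIndepFun_infinitePi (P := fun _ : ℕ => β) (X := fun _ x => x) fun _ => measurable_id

lemma memLp_iid (hmem : MemLp (fun x => x) 2 β) (k : ℕ) :
    MemLp (fun z : ℕ → ℝ => z k) 2 (iid β) :=
  hmem.comp_measurePreserving (measurePreserving_eval_iid k)

lemma integral_iid (k : ℕ) : ∫ z, z k ∂iid β = ∫ x, x ∂β := by
  conv_rhs => rw [← (measurePreserving_eval_iid (β := β) k).map_eq]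
  rw [integral_map (measurable_pi_apply k).aemeasurable (by fun_prop)]

lemma variance_iid (k : ℕ) :
    variance (fun z : ℕ → ℝ => z k) (iid β) = variance (fun x => x) β :=
  (measurePreserving_eval_iid k).variance_fun_comp (f := fun x => x) aemeasurable_id

/-- Central limit theorem at a fixed level. -/
lemma tendsto_measureReal_normalized (hmem : MemLp (fun x => x) 2 β)
    (hv : (variance (fun x => x) β).toNNReal ≠ 0) (c : ℝ) :
    Tendsto (fun n : ℕ => (iid β).real {z | c < (√(n : ℝ))⁻¹ *
      (∑ k ∈ Finset.range n, z k - n * ∫ x, x ∂β)}) atTop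
      (𝓝 (gaussTail (variance (fun x => x) β).toNNReal c)) := by
  have hY : HasLaw (fun x : ℝ => x) (gaussianReal 0
      (variance (fun z : ℕ → ℝ => z 0) (iid β)).toNNReal)
      (gaussianReal 0 (variance (fun x => x) β).toNNReal) := by
    rw [variance_iid]
    exact HasLaw.id
  have hclt := tendstoInDistribution_inv_sqrt_mul_sum_sub (P := iid β)
    (X := fun k z => z k) hY (memLp_iid hmem 0) iIndepFun_iid (fun i =>
      ⟨(measurable_pi_apply i).aemeasurable, (measurable_pi_apply 0).aemeasurable, by
        rw [(measurePreserving_eval_iid i).map_eq, (measurePreserving_eval_iid 0).map_eq]⟩)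
  have := nullSingletonClass_gaussianReal (μ := 0) hv
  have h2 := ProbabilityMeasure.tendsto_measure_of_null_frontier_of_tendsto' hclt.tendsto
    (E := Set.Ioi c) (by
      simp)
  have h3 := (ENNReal.tendsto_toReal (by
    simp only [ProbabilityMeasure.coe_mk]; exact measure_ne_top _ _)).comp h2
  simp only [ProbabilityMeasure.coe_mk, Measure.map_id'] at h3
  refine Tendsto.congr (fun n => ?_) h3
  simp only [Function.comp_apply]
  rw [Measure.map_apply (by fun_prop) measurableSet_Ioi]
  simp only [measureReal_def, integral_iid]
  rfl

/-- Central limit theorem for the tails of partial sums along general levels. -/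
lemma tendsto_measureReal_lt_sum (hmem : MemLp (fun x => x) 2 β)
    (hv : (variance (fun x => x) β).toNNReal ≠ 0) {ι : Type*} {l : Filter ι} {n : ι → ℕ}
    {y : ι → ℝ} {c : ℝ} (hn : Tendsto n l atTop)
    (hy : Tendsto (fun i => (y i - n i * ∫ x, x ∂β) / √(n i : ℝ)) l (𝓝 c)) :
    Tendsto (fun i => (iid β).real {z | y i < ∑ k ∈ Finset.range (n i), z k}) l
      (𝓝 (gaussTail (variance (fun x => x) β).toNNReal c)) := by
  set v := (variance (fun x => x) β).toNNReal
  have hpos : ∀ᶠ i in l, 0 < √(n i : ℝ) := by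
    filter_upwards [hn.eventually_gt_atTop 0] with i hi
    exact Real.sqrt_pos.2 (by exact_mod_cast hi)
  rw [tendsto_order]
  constructor
  · intro a ha
    -- Continuity of the limit lets the moving level be replaced by a fixed `d` slightly beyond `c`.
    obtain ⟨d, hcd, hd⟩ := (((continuous_gaussTail hv).tendsto c).eventually
      (lt_mem_nhds ha)).exists_gt
    have h1 := ((tendsto_measureReal_normalized hmem hv d).comp hn).eventually (lt_mem_nhds hd)
    filter_upwards [h1, hy.eventually (gt_mem_nhds hcd), hpos] with i h1 h2 h3
    refine h1.trans_le (measureReal_mono fun z hz => ?_)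
    rw [div_lt_iff₀ h3] at h2
    have hz' : d < (√(n i : ℝ))⁻¹ * _ := hz
    rw [← div_eq_inv_mul, lt_div_iff₀ h3] at hz'
    change y i < _
    linarith
  · intro a ha
    obtain ⟨d, hcd, hd⟩ := (((continuous_gaussTail hv).tendsto c).eventually
      (gt_mem_nhds ha)).exists_lt
    have h1 := ((tendsto_measureReal_normalized hmem hv d).comp hn).eventually (gt_mem_nhds hd)
    filter_upwards [h1, hy.eventually (lt_mem_nhds hcd), hpos] with i h1 h2 h3
    refine (measureReal_mono fun z hz => ?_).trans_lt h1
    rw [lt_div_iff₀ h3] at h2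
    have hz' : y i < _ := hz
    change d < _
    rw [← div_eq_inv_mul, lt_div_iff₀ h3]
    linarith

/-- Chebyshev's inequality for partial sums. -/
lemma measure_lt_sum_le (hmem : MemLp (fun x => x) 2 β) (t : ℕ) {y : ℝ} (hy : 0 < y) :
    iid β {z | t * ∫ x, x ∂β + y ≤ ∑ k ∈ Finset.range t, z k} ≤
      ENNReal.ofReal (t * variance (fun x => x) β / y ^ 2) := by
  have hm : MemLp (∑ k ∈ Finset.range t, fun z : ℕ → ℝ => z k) 2 (iid β) :=
    memLp_finsetSum' _ fun k _ => memLp_iid hmem k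
  have h1 := meas_ge_le_variance_div_sq hm hy
  rw [IndepFun.variance_sum (fun k _ => memLp_iid hmem k)
    (fun i _ j _ hij => iIndepFun_iid.indepFun hij)] at h1
  simp only [variance_iid, Finset.sum_const, Finset.card_range, nsmul_eq_mul] at h1
  refine (measure_mono fun z hz => ?_).trans h1
  have h2 : ∫ z, (∑ k ∈ Finset.range t, fun z : ℕ → ℝ => z k) z ∂iid β = t * ∫ x, x ∂β := by
    simp only [Finset.sum_apply]
    rw [integral_finsetSum _ fun k _ => (memLp_iid hmem k).integrable one_le_two]
    simp [integral_iid]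
  have hz' : t * ∫ x, x ∂β + y ≤ ∑ k ∈ Finset.range t, z k := hz
  change y ≤ |(∑ k ∈ Finset.range t, fun z : ℕ → ℝ => z k) z - _|
  rw [h2, Finset.sum_apply]
  exact le_trans (by linarith) (le_abs_self _)

end CLT

end HetQCD

/-! ### Second-order asymptotics for a single sensor. -/

namespace HetQCD

open ProbabilityTheory Topology
open scoped NNReal

/-- `α` and `β` are the laws of a log-likelihood ratio before and after the change, with
divergence `I` and finite variance. -/
structure IsLLRLaw (α β : Measure ℝ) (I : ℝ) : Prop where
  tilt : IsExpTilt α β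
  memLp : MemLp (fun x => x) 2 β
  mean : ∫ x, x ∂β = I
  pos : 0 < I

lemma tendsto_pow_mul_exp_neg_mul_sqrt (k : ℕ) {a : ℝ} (ha : 0 < a) :
    Tendsto (fun h : ℝ => h ^ k * Real.exp (-(a * √h))) atTop (𝓝 0) := by
  have h1 := ((Real.tendsto_pow_mul_exp_neg_atTop_nhds_zero (2 * k)).comp
    (Real.tendsto_sqrt_atTop.const_mul_atTop ha)).const_mul (a ^ (2 * k))⁻¹
  rw [mul_zero] at h1
  refine h1.congr' ?_
  filter_upwards [eventually_ge_atTop 0] with h hh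
  simp only [Function.comp_apply]
  rw [mul_pow, pow_mul √h, Real.sq_sqrt hh]
  field_simp

lemma tendsto_div_sqrt_atTop (c : ℝ) : Tendsto (fun h : ℝ => c / √h) atTop (𝓝 0) :=
  tendsto_const_nhds.div_atTop Real.tendsto_sqrt_atTop

/-- The time `h + x √h`, rounded down. -/
noncomputable def floorTime (h x : ℝ) : ℕ := ⌊h + x * √h⌋₊

lemma tendsto_add_mul_sqrt_atTop (x : ℝ) : Tendsto (fun h : ℝ => h + x * √h) atTop atTop := by
  have h1 : Tendsto (fun h : ℝ => √h * (√h + x)) atTop atTop :=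
    Real.tendsto_sqrt_atTop.atTop_mul_atTop₀
      (tendsto_atTop_add_const_right _ x Real.tendsto_sqrt_atTop)
  refine h1.congr' ?_
  filter_upwards [eventually_ge_atTop 0] with h hh
  rw [mul_add, Real.mul_self_sqrt hh, mul_comm x]

lemma tendsto_floorTime (x : ℝ) : Tendsto (fun h => floorTime h x) atTop atTop :=
  tendsto_nat_floor_atTop.comp (tendsto_add_mul_sqrt_atTop x)

lemma tendsto_floorTime_div (x : ℝ) :
    Tendsto (fun h => (floorTime h x : ℝ) / h) atTop (𝓝 1) := by
  have h1 := (tendsto_nat_floor_div_atTop (R := ℝ)).comp (tendsto_add_mul_sqrt_atTop x)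
  have h2 : Tendsto (fun h : ℝ => (h + x * √h) / h) atTop (𝓝 1) := by
    have := (tendsto_div_sqrt_atTop x).const_add 1
    rw [add_zero] at this
    refine this.congr' ?_
    filter_upwards [eventually_gt_atTop 0] with h hh
    have := Real.mul_self_sqrt hh.le
    have := Real.sqrt_pos.2 hh
    field_simp
    linear_combination (-x) * ‹√h * √h = h›
  have h3 := h1.mul h2
  rw [one_mul] at h3
  refine h3.congr' ?_
  filter_upwards [(tendsto_add_mul_sqrt_atTop x).eventually_gt_atTop 0] with h hh
  simp only [Function.comp_apply, floorTime]
  field_simp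

lemma tendsto_level_floorTime (I x : ℝ) {r : ℝ → ℝ} {c : ℝ}
    (hr : Tendsto (fun h => r h / √h) atTop (𝓝 c)) :
    Tendsto (fun h => (I * h + r h - floorTime h x * I) / √(floorTime h x : ℝ)) atTop
      (𝓝 (c - I * x)) := by
  have h1 : Tendsto (fun h => √h / √(floorTime h x : ℝ)) atTop (𝓝 1) := by
    have := ((Real.continuous_sqrt.tendsto 1).comp (tendsto_floorTime_div x)).inv₀ (by simp)
    simp only [Real.sqrt_one, inv_one] at this
    refine this.congr' ?_
    filter_upwards [eventually_gt_atTop 0] with h hh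
    simp [Real.sqrt_div]
  have h2 : Tendsto (fun h => (h + x * √h - floorTime h x) / √h) atTop (𝓝 0) := by
    refine squeeze_zero' ?_ ?_ (tendsto_div_sqrt_atTop 1)
    · filter_upwards [(tendsto_add_mul_sqrt_atTop x).eventually_ge_atTop 0] with h hh
      exact div_nonneg (sub_nonneg.2 (Nat.floor_le hh)) (Real.sqrt_nonneg h)
    · filter_upwards with h
      gcongr
      have := Nat.lt_floor_add_one (h + x * √h)
      rw [floorTime]
      linarith
  have h3 := ((hr.sub_const (I * x)).add (h2.const_mul I)).mul h1
  rw [mul_zero, add_zero, mul_one] at h3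
  refine h3.congr' ?_
  filter_upwards [eventually_gt_atTop 0] with h hh
  have := Real.sqrt_pos.2 hh
  field_simp
  ring

namespace IsLLRLaw

variable {α β : Measure ℝ} [IsProbabilityMeasure β] {I : ℝ}

/-- Dominated convergence with majorant `x ^ 2`. Thus truncating at `K` shifts the mean by only `o(1
/ K)`, which is where finite variance buys an `o(√h)` error. -/
lemma tendsto_mul_sub_integral_min (H : IsLLRLaw α β I) :
    Tendsto (fun K : ℝ => K * (I - ∫ x, min x K ∂β)) atTop (𝓝 0) := by
  have hint : Integrable (fun x => x) β := H.memLp.integrable one_le_two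
  have e : ∀ K : ℝ, K * (I - ∫ x, min x K ∂β) = ∫ x, K * (x - min x K) ∂β := by
    intro K
    have hintK : Integrable (fun x => min x K) β := hint.inf (integrable_const K)
    rw [integral_const_mul, integral_sub hint hintK, H.mean]
  simp_rw [e]
  have hsq : Integrable (fun x : ℝ => x ^ 2) β := H.memLp.integrable_sq
  rw [show (0 : ℝ) = ∫ _, (0 : ℝ) ∂β by simp]
  refine tendsto_integral_filter_of_dominated_convergence (fun x => x ^ 2) ?_ ?_ hsq ?_
  · exact .of_forall fun K => by fun_prop
  · filter_upwards [eventually_ge_atTop 0] with K hK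
    refine .of_forall fun x => ?_
    rcases le_total x K with h | h
    · simp [min_eq_left h, sq_nonneg]
    · rw [min_eq_right h, Real.norm_of_nonneg (mul_nonneg hK (sub_nonneg.2 h))]
      nlinarith
  · refine .of_forall fun x => ?_
    refine tendsto_const_nhds.congr' ?_
    filter_upwards [eventually_ge_atTop x] with K hK
    simp [min_eq_left hK]

/-- The expected detection time of a single sensor is at most `h + o(√h)`. -/
lemma eventually_tsum_not_crossed_le (H : IsLLRLaw α β I) {ε : ℝ} (hε : 0 < ε) :
    ∀ᶠ h : ℝ in atTop, ∑' t, iid β {z | ¬ Crossed 0 z (I * h) t} ≤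
      ENNReal.ofReal (h + ε * √h) := by
  have hI := H.pos
  -- With this truncation level the overshoot and the bias of the mean each cost about `ε / 3 * √h`;
  -- the last third absorbs the division by `J` instead of `I`.
  have hK : Tendsto (fun h => I * ε / 3 * √h) atTop atTop :=
    Real.tendsto_sqrt_atTop.const_mul_atTop (by positivity)
  have h1 := (H.tendsto_mul_sub_integral_min.comp hK).eventually
    (gt_mem_nhds (show 0 < I ^ 2 * ε ^ 2 / 9 by positivity))
  filter_upwards [h1, eventually_gt_atTop 0,
    Real.tendsto_sqrt_atTop.eventually_gt_atTop (max ε 0)] with h h1 h0 h2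
  have hr : 0 < √h := Real.sqrt_pos.2 h0
  have hεr : ε < √h := (le_max_left _ _).trans_lt h2
  set r := √h with hrdef
  have hh : h = r ^ 2 := (Real.sq_sqrt h0.le).symm
  simp only [Function.comp_apply] at h1
  set J := ∫ x, min x (I * ε / 3 * r) ∂β with hJ
  have hJI : I * ε * r - I * ε ^ 2 / 3 ≤ J * (ε * r) := by
    have : ε * I * (r * (I - J)) < ε * I * (I * ε / 3) := by nlinarith
    have : r * (I - J) < I * ε / 3 := lt_of_mul_lt_mul_left this (by positivity)
    nlinarith
  have hJ0 : 0 < J := by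
    by_contra! hneg
    have : J * (ε * r) ≤ 0 := mul_nonpos_of_nonpos_of_nonneg hneg (by positivity)
    have : 0 < I * ε * (r - ε / 3) := by
      have : 0 < r - ε / 3 := by linarith
      positivity
    nlinarith
  refine (tsum_measure_not_crossed_le (K := I * ε / 3 * r) (by positivity)
    (H.memLp.integrable one_le_two) hJ.symm hJ0).trans (ENNReal.ofReal_le_ofReal ?_)
  rw [div_le_iff₀ hJ0, hh]
  have h3 : ε * (I * r ^ 2 + I * ε / 3 * r) ≤ ε * ((r ^ 2 + ε * r) * J) := by
    have h4 := mul_le_mul_of_nonneg_right hJI (show 0 ≤ r + ε by positivity)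
    have h5 : 0 ≤ I * ε ^ 2 * (r - ε) := by
      have : 0 ≤ r - ε := by linarith
      positivity
    nlinarith
  nlinarith [le_of_mul_le_mul_left h3 hε]

variable [IsProbabilityMeasure α]

/-- A degenerate increment would equal `I` almost surely, and then `∫ exp (-x) dβ = 1` would give `I
= 0`. -/
lemma variance_ne_zero (H : IsLLRLaw α β I) : (variance (fun x => x) β).toNNReal ≠ 0 := by
  intro h0
  have h1 : variance (fun x => x) β = 0 :=
    le_antisymm (Real.toNNReal_eq_zero.1 h0) (variance_nonneg _ _)
  have h2 := ae_eq_integral_of_variance_eq_zero H.memLp h1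
  rw [H.mean] at h2
  have h3 := H.tilt.lintegral_exp_neg
  rw [lintegral_congr_ae (g := fun _ => ENNReal.ofReal (Real.exp (-I)))] at h3
  · simp only [lintegral_const, measure_univ, mul_one, ENNReal.ofReal_eq_one,
      Real.exp_eq_one_iff] at h3
    linarith [H.pos]
  · filter_upwards [h2] with x hx
    rw [hx]

/-- The expected time to a false alarm of a single sensor is at most `exp (I h + o(√h))`. -/
lemma eventually_tsum_not_crossed_le_exp (H : IsLLRLaw α β I) {δ : ℝ} (hδ : 0 < δ) :
    ∀ᶠ h : ℝ in atTop, ∑' t, iid α {z | ¬ Crossed 0 z (I * h) t} ≤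
      ENNReal.ofReal (Real.exp (I * (h + δ * √h))) := by
  have hI := H.pos
  have hv := H.variance_ne_zero
  -- Blocks of length about `h`: under `β` the block sum falls in a window of width `I * δ / 2 * √h`
  -- above `I * h` with probability bounded below by some `κ > 0`. Tilting back costs at most `exp
  -- c`, with `c` the top of the window.
  have l1 := tendsto_measureReal_lt_sum H.memLp hv (tendsto_floorTime 0)
    (y := fun h => I * h + 0) (by
      rw [H.mean]
      exact tendsto_level_floorTime I 0 (r := fun _ => 0) (c := 0) (by simp))
  have l2 := tendsto_measureReal_lt_sum H.memLp hv (tendsto_floorTime 0)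
    (y := fun h => I * h + I * δ / 2 * √h) (by
      rw [H.mean]
      refine tendsto_level_floorTime I 0 (r := fun h => I * δ / 2 * √h) (c := I * δ / 2) ?_
      refine tendsto_const_nhds.congr' ?_
      filter_upwards [eventually_gt_atTop 0] with h hh
      have := Real.sqrt_pos.2 hh
      field_simp)
  simp only [mul_zero, sub_zero, add_zero] at l1 l2
  have hκ : 0 < gaussTail (variance (fun x => x) β).toNNReal 0 -
      gaussTail (variance (fun x => x) β).toNNReal (I * δ / 2) :=
    sub_pos.2 (gaussTail_strictAnti hv (by positivity))
  obtain ⟨κ, hκ0, hκ⟩ := exists_between hκ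
  -- The remaining half of the slack, `exp (I * δ / 2 * √h)`, absorbs the factor `n / κ ≤ h / κ`.
  have l3 := (tendsto_pow_mul_exp_neg_mul_sqrt 1 (a := I * δ / 2) (by positivity)).eventually
    (gt_mem_nhds hκ0)
  filter_upwards [(l1.sub l2).eventually (lt_mem_nhds hκ), l3, eventually_ge_atTop 1,
    (tendsto_floorTime 0).eventually_gt_atTop 0] with h h1 h3 h4 hn
  set n := floorTime h 0 with hndef
  have hnh : (n : ℝ) ≤ h := by
    simp only [hndef, floorTime, zero_mul, add_zero]
    exact Nat.floor_le (by linarith)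
  set c := I * h + I * δ / 2 * √h with hc
  have hbc : I * h ≤ c := le_add_of_nonneg_right (by positivity)
  have hp := H.tilt.measure_lt_sum_ge n (I * h) c
  have hm : Measurable fun z : ℕ → ℝ => ∑ i ∈ Finset.range n, z i := by fun_prop
  have h5 : ENNReal.ofReal κ ≤ iid β {z | ∑ i ∈ Finset.range n, z i ∈ Set.Ioc (I * h) c} := by
    refine (ENNReal.ofReal_le_ofReal h1.le).trans ?_
    have hsub : {z : ℕ → ℝ | c < ∑ i ∈ Finset.range n, z i} ⊆
        {z | I * h < ∑ i ∈ Finset.range n, z i} := fun z hz => hbc.trans_lt hz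
    rw [← measureReal_sdiff hsub (measurableSet_lt measurable_const hm), ofReal_measureReal]
    refine measure_mono fun z hz => ⟨hz.1, ?_⟩
    have := hz.2
    simpa using this
  calc ∑' t, iid α {z | ¬ Crossed 0 z (I * h) t}
      ≤ n / iid α {z | I * h < ∑ i ∈ Finset.range n, z i} :=
        tsum_measure_not_crossed_le_div hn _ _
    _ ≤ n / (ENNReal.ofReal (Real.exp (-c)) * ENNReal.ofReal κ) := by
        refine ENNReal.div_le_div_left (le_trans ?_ hp) _
        gcongr
    _ = ENNReal.ofReal (n / (Real.exp (-c) * κ)) := by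
        rw [← ENNReal.ofReal_mul (Real.exp_pos _).le, ENNReal.ofReal_div_of_pos (by positivity),
          ENNReal.ofReal_natCast]
    _ ≤ _ := by
        apply ENNReal.ofReal_le_ofReal
        rw [div_le_iff₀ (by positivity), ← mul_assoc, ← Real.exp_add]
        have e : I * (h + δ * √h) + -c = I * δ / 2 * √h := by rw [hc]; ring
        rw [e]
        rw [pow_one, Real.exp_neg, ← div_eq_mul_inv, div_lt_iff₀ (Real.exp_pos _)] at h3
        linarith

/-- Under the post-change law, the detection time of a single sensor is asymptotically normal. -/
lemma tendsto_measureReal_crossed (H : IsLLRLaw α β I) (x : ℝ) :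
    Tendsto (fun h => (iid β).real {z | Crossed 0 z (I * h) (floorTime h x)}) atTop
      (𝓝 (gaussTail (variance (fun x => x) β).toNNReal (-(I * x)))) := by
  have hI := H.pos
  have hv := H.variance_ne_zero
  have l1 := tendsto_measureReal_lt_sum H.memLp hv (tendsto_floorTime x)
    (y := fun h => I * h + 0) (by
      rw [H.mean]
      exact tendsto_level_floorTime I x (r := fun _ => 0) (c := 0) (by simp))
  -- The slack `√√h` is `o(√h)`, so it does not move the Gaussian limit, yet `exp (-√√h)` beats the
  -- quadratic count of intervals.
  have l2 := tendsto_measureReal_lt_sum H.memLp hv (tendsto_floorTime x)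
    (y := fun h => I * h + -√√h) (by
      rw [H.mean]
      refine tendsto_level_floorTime I x (r := fun h => -√√h) (c := 0) ?_
      have := ((tendsto_div_sqrt_atTop 1).comp Real.tendsto_sqrt_atTop).neg
      rw [neg_zero] at this
      refine this.congr' ?_
      filter_upwards [eventually_gt_atTop 0] with h hh
      have h1 := Real.sqrt_pos.2 hh
      have h2 := Real.sqrt_pos.2 h1
      have h3 := Real.mul_self_sqrt h1.le
      simp only [Function.comp_apply]
      rw [neg_div, neg_inj, div_eq_div_iff h2.ne' h1.ne', h3, one_mul])
  have l3 : Tendsto (fun h => ((floorTime h x : ℝ) + 1) ^ 2 * Real.exp (-√√h)) atTop (𝓝 0) := by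
    have h1 := ((tendsto_pow_mul_exp_neg_mul_sqrt 4 one_pos).comp
      Real.tendsto_sqrt_atTop).const_mul 9
    rw [mul_zero] at h1
    refine squeeze_zero' (.of_forall fun h => by positivity) ?_ h1
    filter_upwards [(tendsto_floorTime_div x).eventually (gt_mem_nhds one_lt_two),
      eventually_ge_atTop 1] with h h2 h3
    rw [div_lt_iff₀ (by linarith)] at h2
    simp only [Function.comp_apply, one_mul]
    rw [← mul_assoc]
    gcongr
    have : √h ^ 4 = h ^ 2 := by
      rw [show 4 = 2 * 2 by norm_num, pow_mul, Real.sq_sqrt (by linarith)]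
    rw [this, show 9 * h ^ 2 = (3 * h) ^ 2 by ring]
    gcongr
    linarith
  have l4 := l2.add l3
  simp only [add_zero, zero_sub] at l1 l4
  refine tendsto_of_tendsto_of_tendsto_of_le_of_le' l1 l4 ?_ ?_
  · filter_upwards [(tendsto_floorTime x).eventually_gt_atTop 0] with h hn
    refine measureReal_mono fun z hz => ⟨floorTime h x, le_rfl, ?_⟩
    have := le_cusumFrom 0 z hn
    rw [← Finset.range_eq_Ico] at this
    exact lt_of_lt_of_le hz this
  · filter_upwards [eventually_ge_atTop 0] with h hh
    have := H.tilt.measure_crossed_le (b := I * h) (by positivity) (√√h) (floorTime h x)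
    rw [← ENNReal.toReal_le_toReal (measure_ne_top _ _)
      (ENNReal.add_ne_top.2 ⟨measure_ne_top _ _, ENNReal.ofReal_ne_top⟩),
      ENNReal.toReal_add (measure_ne_top _ _) ENNReal.ofReal_ne_top,
      ENNReal.toReal_ofReal (by positivity)] at this
    exact this

/-- Polynomial bound for the probability of an early detection. -/
lemma exists_measureReal_crossed_le (H : IsLLRLaw α β I) :
    ∃ C : ℝ, 0 ≤ C ∧ ∀ h ≥ 1, ∀ x ≥ 1, x ≤ √h →
      (iid β).real {z | Crossed 0 z (I * h) (floorTime h (-x))} ≤ C / x ^ 2 := by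
  have hI := H.pos
  have hv := variance_nonneg (fun x : ℝ => x) β
  set v := variance (fun x => x) β with hvdef
  -- The slack `a` is half the drift deficit `I * x * √h`. Chebyshev for the other half gives the
  -- first constant; `a ^ 4 / 24 ≤ exp a` gives the second, `1536 = 4 * 16 * 24`.
  refine ⟨4 * v / I ^ 2 + 1536 / I ^ 4, by positivity, fun h hh x hx hxh => ?_⟩
  set r := √h with hr
  have hrr : r ^ 2 = h := Real.sq_sqrt (by linarith)
  have hr1 : 1 ≤ r := hx.trans hxh
  set t := floorTime h (-x) with ht
  have hth : (t : ℝ) ≤ h - x * r := by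
    have h0 : 0 ≤ h + -x * r := by nlinarith
    have := Nat.floor_le h0
    simp only [ht, floorTime]
    linarith
  have hth' : (t : ℝ) ≤ h := hth.trans (by nlinarith)
  set a := I * x * r / 2 with ha
  have ha0 : 0 < a := by positivity
  have h1 := H.tilt.measure_crossed_le (b := I * h) (by positivity) a t
  have h2 : iid β {z | I * h - a < ∑ i ∈ Finset.range t, z i} ≤
      ENNReal.ofReal (t * v / a ^ 2) := by
    refine (measure_mono fun z hz => ?_).trans (measure_lt_sum_le H.memLp t ha0)
    rw [H.mean]
    have hz' : I * h - a < ∑ i ∈ Finset.range t, z i := hz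
    change t * I + a ≤ _
    have : I * t ≤ I * (h - x * r) := by gcongr
    nlinarith
  have h3 := h1.trans (add_le_add_left h2 _)
  rw [← ENNReal.ofReal_add (by positivity) (by positivity)] at h3
  refine (ENNReal.toReal_le_of_le_ofReal (by positivity) h3).trans ?_
  have h4 : (t : ℝ) * v / a ^ 2 ≤ 4 * v / I ^ 2 / x ^ 2 := by
    rw [div_div, div_le_div_iff₀ (by positivity) (by positivity)]
    have : a ^ 2 = I ^ 2 * x ^ 2 * h / 4 := by rw [ha, ← hrr]; ring
    rw [this]
    have : (t : ℝ) * (v * (I ^ 2 * x ^ 2)) ≤ h * (v * (I ^ 2 * x ^ 2)) := by gcongr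
    nlinarith
  have h5 : ((t : ℝ) + 1) ^ 2 * Real.exp (-a) ≤ 1536 / I ^ 4 / x ^ 2 := by
    have e1 : a ^ 4 / 24 ≤ Real.exp a := by
      have := Real.pow_div_factorial_le_exp a ha0.le 4
      norm_num [Nat.factorial] at this
      exact this
    have e2 : ((t : ℝ) + 1) ^ 2 ≤ (2 * h) ^ 2 := by gcongr; linarith
    have e3 : a ^ 4 = I ^ 4 * x ^ 4 * h ^ 2 / 16 := by rw [ha, ← hrr]; ring
    have e4 : x ^ 2 ≤ x ^ 4 := pow_le_pow_right₀ hx (by norm_num)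
    rw [Real.exp_neg, ← div_eq_mul_inv, div_div, div_le_div_iff₀ (Real.exp_pos _) (by positivity)]
    calc ((t : ℝ) + 1) ^ 2 * (I ^ 4 * x ^ 2) ≤ (2 * h) ^ 2 * (I ^ 4 * x ^ 4) := by gcongr
      _ = 1536 * (a ^ 4 / 24) := by rw [e3]; ring
      _ ≤ _ := by gcongr
  rw [add_div]
  exact add_le_add h4 h5

end IsLLRLaw

end HetQCD

/-! ### From observations to independent log-likelihood ratios: `ARL` and `EDD` as sums of tail
probabilities. -/

namespace HetQCD

open ProbabilityTheory Topology

variable {L : ℕ} {𝒳 : Fin L → Type*} [∀ l, MeasurableSpace (𝒳 l)] {N : Fin L → ℕ}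

/-- The first maximum with `0` erases a negative start, so `0` is the least favourable one. At time
`0` itself this fails, hence `s + 1`. -/
lemma cusumFrom_zero_succ_le (w : ℝ) (z : ℕ → ℝ) (s : ℕ) :
    cusumFrom 0 z (s + 1) ≤ cusumFrom w z (s + 1) := by
  induction s with
  | zero => simp [cusumFrom_succ]
  | succ s ih =>
    rw [cusumFrom_succ, cusumFrom_succ w]
    gcongr

section Counting

/-- The sensors of `D` whose CUSUM statistic has exceeded its threshold by time `t`, as a function
of the log-likelihood ratios. -/
def alarmedSet (h : Fin L → ℝ) (D : Set (Sensor N)) (t : ℕ) (ζ : Sensor N → ℕ → ℝ) :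
    Set (Sensor N) := {i | i ∈ D ∧ Crossed 0 (ζ i) (h i.1) t}

lemma alarmedSet_mono_time (h : Fin L → ℝ) (D : Set (Sensor N)) {s t : ℕ} (hst : s ≤ t)
    (ζ : Sensor N → ℕ → ℝ) : alarmedSet h D s ζ ⊆ alarmedSet h D t ζ :=
  fun _ hi => ⟨hi.1, hi.2.mono_time hst⟩

lemma measurableSet_ncard_alarmedSet_lt (h : Fin L → ℝ) (D : Set (Sensor N)) (t M : ℕ) :
    MeasurableSet {ζ : Sensor N → ℕ → ℝ | (alarmedSet h D t ζ).ncard < M} := by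
  have e : {ζ : Sensor N → ℕ → ℝ | (alarmedSet h D t ζ).ncard < M} =
      ⋃ B ∈ {B : Set (Sensor N) | B.ncard < M}, {ζ | alarmedSet h D t ζ = B} := by
    ext ζ; simp
  rw [e]
  refine MeasurableSet.biUnion (Set.to_countable _) fun B _ => ?_
  have e2 : {ζ : Sensor N → ℕ → ℝ | alarmedSet h D t ζ = B} =
      ⋂ i, {ζ | (i ∈ D ∧ Crossed 0 (ζ i) (h i.1) t) ↔ i ∈ B} := by
    ext ζ; simp [alarmedSet, Set.ext_iff]
  rw [e2]
  refine MeasurableSet.iInter fun i => ?_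
  have h1 : MeasurableSet {ζ : Sensor N → ℕ → ℝ | i ∈ D ∧ Crossed 0 (ζ i) (h i.1) t} :=
    (MeasurableSet.const (i ∈ D)).inter
      (measurableSet_preimage (f := fun ζ : Sensor N → ℕ → ℝ => ζ i) (measurable_pi_apply i)
        (measurableSet_crossed_seq 0 (h i.1) t))
  by_cases hB : i ∈ B
  · simpa [hB] using h1
  · have := h1.compl
    convert this using 1
    ext ζ
    simp [hB]

/-- The law of independent sensors with i.i.d. log-likelihood ratios, of law `α l` for the
sensors of group `l`. -/
noncomputable def sensorLaw (N : Fin L → ℕ) (α : Fin L → Measure ℝ) :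
    Measure (Sensor N → ℕ → ℝ) :=
  Measure.infinitePi fun i => iid (α i.1)

instance (α : Fin L → Measure ℝ) [∀ l, IsProbabilityMeasure (α l)] :
    IsProbabilityMeasure (sensorLaw N α) := by
  unfold sensorLaw; infer_instance

lemma sensorLaw_eval (α : Fin L → Measure ℝ) [∀ l, IsProbabilityMeasure (α l)] (i : Sensor N)
    {A : Set (ℕ → ℝ)} (hA : MeasurableSet A) :
    sensorLaw N α {ζ | ζ i ∈ A} = iid (α i.1) A :=
  (measurePreserving_eval_infinitePi (fun i : Sensor N => iid (α i.1)) i).measure_preimage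
    hA.nullMeasurableSet

lemma toENNReal_eq_tsum (n : ℕ∞) :
    (n : ℝ≥0∞) = ∑' t : ℕ, if (t : ℕ∞) < n then 1 else 0 := by
  induction n using ENat.recTopCoe with
  | top => simp
  | coe k =>
    rw [tsum_eq_sum (s := Finset.range k)]
    · simp only [Nat.cast_lt, Finset.sum_ite, Finset.sum_const_zero, add_zero, Finset.sum_const]
      rw [Finset.filter_true_of_mem fun t ht => Finset.mem_range.1 ht]
      simp
    · intro t ht
      simpa using ht

end Counting

variable (f g : ∀ l, Measure (𝒳 l))

/-- The log-likelihood ratios of all observations. -/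
noncomputable def llrSeq (ω : Obs 𝒳 N) : Sensor N → ℕ → ℝ :=
  fun i t => llr (g i.1) (f i.1) (ω (i, t + 1))

lemma measurable_llrSeq : Measurable (llrSeq f g : Obs 𝒳 N → Sensor N → ℕ → ℝ) := by
  refine measurable_pi_iff.2 fun i => measurable_pi_iff.2 fun t => ?_
  exact (measurable_llr _ _).comp (measurable_pi_apply (X := fun p : Sensor N × ℕ => 𝒳 p.1.1) _)

lemma cusum_eq (i : Sensor N) (ω : Obs 𝒳 N) (t : ℕ) :
    cusum f g i ω t = cusumFrom 0 (llrSeq f g ω i) t := by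
  induction t with
  | zero => rfl
  | succ t ih => rw [cusum, cusumFrom_succ, ih]; rfl

lemma lt_alarmWithin_iff (M : ℕ) (h : Fin L → ℝ) (D : Set (Sensor N)) (ω : Obs 𝒳 N) (t : ℕ) :
    (t : ℕ∞) < alarmWithin f g M h D ω ↔ (alarmedSet h D t (llrSeq f g ω)).ncard < M := by
  have e : alarmWithin f g M h D ω =
      ⨅ (t : ℕ) (_ : M ≤ (alarmedSet h D t (llrSeq f g ω)).ncard), (t : ℕ∞) := by
    simp only [alarmWithin, alarmedSet, Crossed, cusum_eq]
  rw [e]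
  constructor
  · intro h1
    by_contra! h2
    exact h1.not_ge (iInf₂_le t h2)
  · intro h1
    have h2 : ((t + 1 : ℕ) : ℕ∞) ≤
        ⨅ (t : ℕ) (_ : M ≤ (alarmedSet h D t (llrSeq f g ω)).ncard), (t : ℕ∞) := by
      refine le_iInf₂ fun s hs => ?_
      rw [Nat.cast_le]
      by_contra! hst
      exact absurd (hs.trans (Set.ncard_le_ncard
        (alarmedSet_mono_time h D (Nat.lt_succ_iff.1 hst) _) (Set.toFinite _))) h1.not_ge
    exact lt_of_lt_of_le (by exact_mod_cast t.lt_succ_self) h2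

/-- The σ-algebra on `Ω` is left free so that it can be the one generated by the observations after
`ν`. -/
lemma measurable_alarmWithin_of_llrSeq (M : ℕ) (h : Fin L → ℝ) (D : Set (Sensor N))
    {Ω : Type*} {m : MeasurableSpace Ω} {X : Ω → Obs 𝒳 N}
    (hX : Measurable fun ω => llrSeq f g (X ω)) :
    Measurable fun ω => (alarmWithin f g M h D (X ω) : ℝ≥0∞) := by
  simp_rw [toENNReal_eq_tsum, lt_alarmWithin_iff]
  exact Measurable.tsum fun t => Measurable.ite
    (hX (measurableSet_ncard_alarmedSet_lt h D t M)) measurable_const measurable_const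

lemma lintegral_alarmWithin {P : Measure (Obs 𝒳 N)} {α : Fin L → Measure ℝ}
    (hP : P.map (llrSeq f g) = sensorLaw N α) (M : ℕ) (h : Fin L → ℝ) (D : Set (Sensor N)) :
    ∫⁻ ω, (alarmWithin f g M h D ω : ℝ≥0∞) ∂P =
      ∑' t, sensorLaw N α {ζ | (alarmedSet h D t ζ).ncard < M} := by
  have hm := fun t => measurableSet_ncard_alarmedSet_lt h D t M
  simp_rw [toENNReal_eq_tsum, lt_alarmWithin_iff]
  have hm' : ∀ t, MeasurableSet {ω : Obs 𝒳 N | (alarmedSet h D t (llrSeq f g ω)).ncard < M} :=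
    fun t => (measurable_llrSeq f g) (hm t)
  rw [lintegral_tsum fun t => (Measurable.ite (hm' t)
    measurable_const measurable_const).aemeasurable]
  refine tsum_congr fun t => ?_
  rw [← hP, Measure.map_apply (measurable_llrSeq f g) (hm t),
    ← lintegral_indicator_one ((measurable_llrSeq f g) (hm t))]
  refine lintegral_congr fun ω => ?_
  simp only [Set.indicator, Set.mem_preimage, Set.mem_ofPred_eq, Pi.one_apply]

/-- The observations after time `ν`. -/
def shiftObs (ν : ℕ) (ω : Obs 𝒳 N) : Obs 𝒳 N := fun p => ω (p.1, p.2 + ν)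

lemma measurable_shiftObs (ν : ℕ) : Measurable (shiftObs ν : Obs 𝒳 N → Obs 𝒳 N) :=
  measurable_pi_iff.2 fun p =>
    measurable_pi_apply (X := fun p : Sensor N × ℕ => 𝒳 p.1.1) (p.1, p.2 + ν)

lemma alarmWithin_sub_le (M : ℕ) (h : Fin L → ℝ) (D : Set (Sensor N)) (ν : ℕ) (ω : Obs 𝒳 N) :
    alarmWithin f g M h D ω - (ν : ℕ∞) ≤ alarmWithin f g M h D (shiftObs ν ω) := by
  rw [tsub_le_iff_right]
  by_contra! hlt
  obtain ⟨t, ht⟩ := ENat.ne_top_iff_exists.1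
    (ne_top_of_lt (lt_of_le_of_lt le_self_add hlt))
  rw [← ht, ← Nat.cast_add, lt_alarmWithin_iff] at hlt
  have h1 : ¬ ((t : ℕ∞) < alarmWithin f g M h D (shiftObs ν ω)) := by rw [ht]; exact lt_irrefl _
  rw [lt_alarmWithin_iff] at h1
  refine h1 (lt_of_le_of_lt (Set.ncard_le_ncard ?_ (Set.toFinite _)) hlt)
  rintro i ⟨hi, s, hs, hlt⟩
  refine ⟨hi, ?_⟩
  rcases s with _ | s
  -- A crossing at time `0` means a negative threshold, which the unshifted statistic also exceeds
  -- at time `0`.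
  · exact ⟨0, by omega, hlt⟩
  refine ⟨ν + (s + 1), by omega, hlt.trans_le ?_⟩
  rw [cusumFrom_add 0 (llrSeq f g ω i) ν (s + 1)]
  have e : llrSeq f g (shiftObs ν ω) i = fun n => llrSeq f g ω i (ν + n) := by
    funext n
    simp only [llrSeq, shiftObs]
    rw [show n + 1 + ν = ν + n + 1 by ring]
  rw [e]
  exact cusumFrom_zero_succ_le _ _ s

variable [∀ l, IsProbabilityMeasure (f l)] [∀ l, IsProbabilityMeasure (g l)]

instance (ν : ℕ∞) (p : Sensor N × ℕ) :
    IsProbabilityMeasure (if (p.2 : ℕ∞) ≤ ν then f p.1.1 else g p.1.1) := by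
  split_ifs <;> infer_instance

instance (ν : ℕ∞) : IsProbabilityMeasure (law N f g ν) := by
  unfold law; infer_instance

/-- If all the observations that matter have the laws `μ`, then the log-likelihood ratios are
independent with the image laws. -/
lemma map_llrSeq_law (ν : ℕ∞) (μ : ∀ l, Measure (𝒳 l)) [∀ l, IsProbabilityMeasure (μ l)]
    (hμ : ∀ (i : Sensor N) (t : ℕ),
      (if ((t + 1 : ℕ) : ℕ∞) ≤ ν then f i.1 else g i.1) = μ i.1) :
    (law N f g ν).map (llrSeq f g) =
      sensorLaw N fun l => (μ l).map (llr (g l) (f l)) := by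
  have hprob : ∀ l, IsProbabilityMeasure ((μ l).map (llr (g l) (f l))) := fun l =>
    Measure.isProbabilityMeasure_map (measurable_llr _ _).aemeasurable
  -- The shift by one drops the dummy coordinate at time `0`; currying then groups the coordinates
  -- by sensor.
  let φ : Sensor N × ℕ → Sensor N × ℕ := fun p => (p.1, p.2 + 1)
  have hφ : Function.Injective φ := by
    rintro ⟨i, s⟩ ⟨j, t⟩ h
    simpa [φ] using h
  have h1 := Measure.map_infinitePi_infinitePi_of_inj
    (P := fun p : Sensor N × ℕ => if (p.2 : ℕ∞) ≤ ν then f p.1.1 else g p.1.1) hφ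
  have h2 : (fun p : Sensor N × ℕ => if (((φ p).2 : ℕ) : ℕ∞) ≤ ν then f (φ p).1.1
      else g (φ p).1.1) = fun p : Sensor N × ℕ => μ p.1.1 := by
    funext p
    exact hμ p.1 p.2
  rw [h2] at h1
  have h3 := Measure.infinitePi_map_pi (fun p : Sensor N × ℕ => μ p.1.1)
    (f := fun p => llr (g p.1.1) (f p.1.1)) (fun p => measurable_llr _ _)
  have h4 := Measure.infinitePi_map_curry
    (fun (i : Sensor N) (_ : ℕ) => (μ i.1).map (llr (g i.1) (f i.1)))
  unfold sensorLaw iid law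
  rw [← h4, ← h3, ← h1, Measure.map_map, Measure.map_map]
  · rfl
  · exact (MeasurableEquiv.measurable _).comp
      (measurable_pi_iff.2 fun p => (measurable_llr _ _).comp (measurable_pi_apply p))
  · exact measurable_pi_iff.2 fun p => measurable_pi_apply (φ p)
  · exact MeasurableEquiv.measurable _
  · exact measurable_pi_iff.2 fun p => (measurable_llr _ _).comp (measurable_pi_apply p)

lemma map_llrSeq_law_top :
    (law N f g ⊤).map (llrSeq f g) = sensorLaw N fun l => (f l).map (llr (g l) (f l)) :=
  map_llrSeq_law f g ⊤ f fun i t => by simp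

lemma map_llrSeq_law_zero :
    (law N f g 0).map (llrSeq f g) = sensorLaw N fun l => (g l).map (llr (g l) (f l)) :=
  map_llrSeq_law f g 0 g fun i t => by simp

lemma ARL_alarmWithin (M : ℕ) (h : Fin L → ℝ) (D : Set (Sensor N)) :
    ARL f g (alarmWithin f g M h D) =
      ∑' t, sensorLaw N (fun l => (f l).map (llr (g l) (f l)))
        {ζ | (alarmedSet h D t ζ).ncard < M} :=
  lintegral_alarmWithin f g (map_llrSeq_law_top f g) M h D

/-- The worst-case delay is at least the expected delay when the change happens at time `0`. -/
lemma lintegral_le_EDD (ρ : Obs 𝒳 N → ℕ∞) :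
    ∫⁻ ω, (ρ ω : ℝ≥0∞) ∂law N f g 0 ≤ EDD f g ρ := by
  refine le_trans (le_of_eq ?_) (le_iSup _ 0)
  have h0 : (observed 𝒳 N) 0 = ⊥ := by
    change (⨆ (i : Sensor N) (s ∈ Set.Icc 1 0), _) = ⊥
    simp
  rw [h0]
  simp only [Nat.cast_zero, tsub_zero]
  rw [condLExp_bot, essSup_const _ (IsProbabilityMeasure.ne_zero _)]

/-- The laws agree even at the dummy time `0`: it receives the observation at time `ν`, still
pre-change, and `law N f g 0` also puts `f` there. -/
lemma map_shiftObs_law (ν : ℕ) : (law N f g ν).map (shiftObs ν) = law N f g 0 := by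
  let φ : Sensor N × ℕ → Sensor N × ℕ := fun p => (p.1, p.2 + ν)
  have hφ : Function.Injective φ := by
    rintro ⟨i, s⟩ ⟨j, t⟩ h
    simpa [φ] using h
  have h1 := Measure.map_infinitePi_infinitePi_of_inj
    (P := fun p : Sensor N × ℕ => if (p.2 : ℕ∞) ≤ (ν : ℕ∞) then f p.1.1 else g p.1.1) hφ
  have h2 : (fun p : Sensor N × ℕ => if (((φ p).2 : ℕ) : ℕ∞) ≤ (ν : ℕ∞) then f (φ p).1.1
      else g (φ p).1.1) =
      fun p : Sensor N × ℕ => if (p.2 : ℕ∞) ≤ 0 then f p.1.1 else g p.1.1 := by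
    funext p
    have : (((p.2 + ν : ℕ) : ℕ∞) ≤ (ν : ℕ∞)) ↔ (p.2 : ℕ∞) ≤ 0 := by
      rw [Nat.cast_le]; simp
    simp only [φ, this]
  rw [h2] at h1
  exact h1


/-- The worst-case delay of the alarm rules is attained when the change happens at time `0`. -/
lemma EDD_alarmWithin_le (M : ℕ) (h : Fin L → ℝ) (D : Set (Sensor N)) :
    EDD f g (alarmWithin f g M h D) ≤
      ∫⁻ ω, (alarmWithin f g M h D ω : ℝ≥0∞) ∂law N f g 0 := by
  refine iSup_le fun ν => essSup_le_of_ae_le _ ?_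
  set P := law N f g ν with hP
  set Y : Obs 𝒳 N → ℝ≥0∞ := fun ω => (alarmWithin f g M h D (shiftObs ν ω) : ℝ≥0∞) with hY
  set m : Sensor N × ℕ → MeasurableSpace (Obs 𝒳 N) :=
    fun p => MeasurableSpace.comap (fun ω : Obs 𝒳 N => ω p) inferInstance with hmdef
  have hle : ∀ p, m p ≤ (inferInstance : MeasurableSpace (Obs 𝒳 N)) :=
    fun p => (measurable_pi_apply (X := fun p : Sensor N × ℕ => 𝒳 p.1.1) p).comap_le
  have hindep : iIndep m P :=
    iIndepFun_infinitePi
      (P := fun p : Sensor N × ℕ => if (p.2 : ℕ∞) ≤ (ν : ℕ∞) then f p.1.1 else g p.1.1)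
      (X := fun _ x => x) fun _ => measurable_id
  set S : Set (Sensor N × ℕ) := {p | p.2 ≤ ν} with hS
  have hind : Indep (⨆ p ∈ S, m p) (⨆ p ∈ Sᶜ, m p) P :=
    indep_iSup_of_disjoint hle hindep disjoint_compl_right
  have hobs : (observed 𝒳 N) ν ≤ ⨆ p ∈ S, m p :=
    iSup_le fun i => iSup₂_le fun s hs => le_iSup₂_of_le (f := fun p (_ : p ∈ S) => m p)
      ((i, s) : Sensor N × ℕ) hs.2 le_rfl
  have hYm : Measurable[⨆ p ∈ Sᶜ, m p] Y := by
    refine @measurable_alarmWithin_of_llrSeq _ _ _ _ f g M h D _ (⨆ p ∈ Sᶜ, m p) (shiftObs ν) ?_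
    refine @measurable_pi_iff _ _ _ (⨆ p ∈ Sᶜ, m p) _ _ |>.2 fun i =>
      @measurable_pi_iff _ _ _ (⨆ p ∈ Sᶜ, m p) _ _ |>.2 fun t => ?_
    refine (measurable_llr _ _).comp ?_
    have h1 : ((i, t + 1 + ν) : Sensor N × ℕ) ∈ Sᶜ := by
      simp only [hS, Set.mem_compl_iff, Set.mem_ofPred_eq]; omega
    exact measurable_iff_comap_le.2
      (le_iSup₂_of_le (f := fun p (_ : p ∈ Sᶜ) => m p) ((i, t + 1 + ν) : Sensor N × ℕ) h1 le_rfl)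
  have hYm' : Measurable Y := hYm.mono (iSup₂_le fun p _ => hle p) le_rfl
  have hYint : ∫⁻ ω, Y ω ∂P = ∫⁻ ω, (alarmWithin f g M h D ω : ℝ≥0∞) ∂law N f g 0 := by
    rw [← map_shiftObs_law f g ν, lintegral_map _ (measurable_shiftObs ν)]
    exact measurable_alarmWithin_of_llrSeq f g M h D (X := fun ω => ω) (measurable_llrSeq f g)
  have hmono : (fun ω => ((alarmWithin f g M h D ω - (ν : ℕ∞) : ℕ∞) : ℝ≥0∞)) ≤ᵐ[P] Y :=
    .of_forall fun ω => ENat.toENNReal_le.2 (alarmWithin_sub_le f g M h D ν ω)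
  -- `Y` reads only times after `ν`, hence is independent of the past and has a constant conditional
  -- expectation.
  have hcond : (fun _ => ∫⁻ ω, Y ω ∂P) =ᵐ[P] P⁻[Y | (observed 𝒳 N) ν] := by
    refine ae_eq_condLExp ((observed 𝒳 N).le ν) P Y measurable_const fun s hs => ?_
    have hone : Measurable[(observed 𝒳 N) ν] (s.indicator (1 : Obs 𝒳 N → ℝ≥0∞)) :=
      @Measurable.indicator _ _ s 1 ((observed 𝒳 N) ν) _ _
        (@measurable_const _ _ _ ((observed 𝒳 N) ν) 1) hs
    have h1 := lintegral_mul_eq_lintegral_mul_lintegral_of_independent_measurableSpace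
      (f := s.indicator 1) ((observed 𝒳 N).le ν) (iSup₂_le fun p _ => hle p)
      (indep_of_indep_of_le_left hind hobs) hone hYm
    have hs' : MeasurableSet s := (observed 𝒳 N).le ν s hs
    rw [lintegral_const, ← lintegral_indicator hs', Measure.restrict_apply_univ, mul_comm]
    rw [lintegral_indicator_one hs'] at h1
    rw [← h1]
    refine lintegral_congr fun ω => ?_
    by_cases hω : ω ∈ s <;> simp [hω]
  filter_upwards [condLExp_mono (mΩ := (observed 𝒳 N) ν) hmono, hcond] with ω h1 h2
  rw [← hYint]
  exact h1.trans h2.ge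

lemma EDD_alarmWithin (M : ℕ) (h : Fin L → ℝ) (D : Set (Sensor N)) :
    EDD f g (alarmWithin f g M h D) =
      ∑' t, sensorLaw N (fun l => (g l).map (llr (g l) (f l)))
        {ζ | (alarmedSet h D t ζ).ncard < M} := by
  rw [← lintegral_alarmWithin f g (map_llrSeq_law_zero f g) M h D]
  exact le_antisymm (EDD_alarmWithin_le f g M h D) (lintegral_le_EDD f g _)

end HetQCD

/-! ### Counts of independent events, and expectations from rescaled tail probabilities. -/

namespace HetQCD

open ProbabilityTheory Topology

section BernoulliCount

variable {ι : Type*} [Fintype ι] [DecidableEq ι]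

/-- The probability that exactly the events in `B` occur, among independent events of
probabilities `p`. -/
def bernoulliWeight (p : ι → ℝ) (B : Finset ι) : ℝ := ∏ i, if i ∈ B then p i else 1 - p i

/-- The probability that fewer than `m` among independent events of probabilities `p` occur. -/
def probFewer (p : ι → ℝ) (m : ℕ) : ℝ := ∑ B : Finset ι with B.card < m, bernoulliWeight p B

lemma sum_bernoulliWeight (p : ι → ℝ) : ∑ B : Finset ι, bernoulliWeight p B = 1 := by
  have h := Finset.prod_add p (fun i => 1 - p i) Finset.univ
  simp only [add_sub_cancel, Finset.prod_const_one, Finset.powerset_univ] at h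
  rw [h]
  refine Finset.sum_congr rfl fun B _ => ?_
  rw [bernoulliWeight, Finset.prod_ite]
  congr 1
  · exact Finset.prod_congr (by ext; simp) fun _ _ => rfl
  · exact Finset.prod_congr (by ext; simp) fun _ _ => rfl

lemma bernoulliWeight_one_sub (p : ι → ℝ) (B : Finset ι) :
    bernoulliWeight (fun i => 1 - p i) B = bernoulliWeight p Bᶜ := by
  refine Finset.prod_congr rfl fun i _ => ?_
  by_cases hi : i ∈ B <;> simp [hi]

lemma bernoulliWeight_pos {p : ι → ℝ} (h0 : ∀ i, 0 < p i) (h1 : ∀ i, p i < 1) (B : Finset ι) :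
    0 < bernoulliWeight p B := by
  refine Finset.prod_pos fun i _ => ?_
  split_ifs
  exacts [h0 i, sub_pos.2 (h1 i)]

lemma continuous_probFewer (m : ℕ) : Continuous fun p : ι → ℝ => probFewer p m := by
  refine continuous_finsetSum _ fun B _ => continuous_finsetProd _ fun i _ => ?_
  split_ifs <;> fun_prop

/-- Replacing `p` by `1 - p` exchanges a set with its complement. One of the two always has at most
`k` elements, and for a set of size exactly `k` both do, which makes the inequality strict. -/
lemma one_lt_probFewer_add {p : ι → ℝ} (h0 : ∀ i, 0 < p i) (h1 : ∀ i, p i < 1) {k : ℕ}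
    (hk : k ≤ Fintype.card ι) (hk2 : Fintype.card ι < 2 * k + 1) :
    1 < probFewer p (k + 1) + probFewer (fun i => 1 - p i) (k + 1) := by
  have e1 : probFewer (fun i => 1 - p i) (k + 1) =
      ∑ B : Finset ι, if Bᶜ.card < k + 1 then bernoulliWeight p B else 0 := by
    rw [probFewer, Finset.sum_filter, ← Equiv.sum_comp (compl_involutive (α := Finset ι)).toPerm]
    refine Finset.sum_congr rfl fun B _ => ?_
    simp only [Function.Involutive.coe_toPerm, bernoulliWeight_one_sub, compl_compl]
  rw [e1, probFewer, Finset.sum_filter, ← Finset.sum_add_distrib, ← sum_bernoulliWeight p]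
  obtain ⟨B₀, -, hB₀⟩ := Finset.exists_subset_card_eq (s := (Finset.univ : Finset ι)) (n := k)
    (by simpa using hk)
  refine Finset.sum_lt_sum (fun B _ => ?_) ⟨B₀, Finset.mem_univ _, ?_⟩
  · have hw := bernoulliWeight_pos h0 h1 B
    have hc := Finset.card_compl B
    have hB := Finset.card_le_univ B
    by_cases hB1 : B.card < k + 1
    · rw [if_pos hB1]
      split_ifs <;> linarith
    · rw [if_neg hB1, if_pos (by omega)]
      linarith
  · have hw := bernoulliWeight_pos h0 h1 B₀
    have hc := Finset.card_compl B₀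
    rw [if_pos (by omega), if_pos (by omega)]
    linarith

/-- The number of events of given marginals that occur under a product measure. -/
lemma measureReal_infinitePi_ncard_lt {E : ι → Type*} [∀ i, MeasurableSpace (E i)]
    (μ : ∀ i, Measure (E i)) [∀ i, IsProbabilityMeasure (μ i)] {A : ∀ i, Set (E i)}
    (hA : ∀ i, MeasurableSet (A i)) (m : ℕ) :
    (Measure.infinitePi μ).real {x | {i | x i ∈ A i}.ncard < m} =
      probFewer (fun i => (μ i).real (A i)) m := by
  classical
  have e : {x : ∀ i, E i | {i | x i ∈ A i}.ncard < m} =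
      ⋃ B ∈ Finset.univ.filter fun B : Finset ι => B.card < m,
        Set.univ.pi fun i => if i ∈ B then A i else (A i)ᶜ := by
    ext x
    simp only [Set.mem_ofPred_eq, Set.mem_iUnion, Finset.mem_filter, Finset.mem_univ, true_and,
      Set.mem_pi, exists_prop]
    constructor
    · intro h
      refine ⟨Finset.univ.filter fun i => x i ∈ A i, ?_, fun i => ?_⟩
      · rw [← Set.ncard_coe_finset]
        simpa using h
      · by_cases hi : x i ∈ A i <;> simp [hi]
    · rintro ⟨B, hB, h⟩
      have : {i | x i ∈ A i} = (B : Set ι) := by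
        ext i
        have := h i
        by_cases hi : i ∈ B
        · simpa [hi] using this
        · simpa [hi] using this
      rwa [this, Set.ncard_coe_finset]
  have hm : ∀ B : Finset ι, ∀ i, MeasurableSet (if i ∈ B then A i else (A i)ᶜ) := by
    intro B i
    split_ifs
    exacts [hA i, (hA i).compl]
  rw [e, measureReal_biUnion_finset]
  · refine Finset.sum_congr rfl fun B _ => ?_
    rw [measureReal_def, Measure.infinitePi_eq_pi, Measure.pi_pi, ENNReal.toReal_prod]
    refine Finset.prod_congr rfl fun i _ => ?_
    split_ifs
    · rfl
    · rw [← measureReal_def, probReal_compl_eq_one_sub (hA i)]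
  · intro B _ B' _ hne
    refine Set.disjoint_left.2 fun x h h' => hne ?_
    ext i
    have h1 := h i trivial
    have h2 := h' i trivial
    by_cases hi : i ∈ B <;> by_cases hi' : i ∈ B' <;> simp_all
  · intro B _
    exact MeasurableSet.univ_pi (hm B)

end BernoulliCount

lemma antitone_floorTime {S : ℕ → ℝ} (hS : Antitone S) (h : ℝ) :
    Antitone fun x => S (floorTime h x) :=
  fun x y hxy => hS (Nat.floor_le_floor (by gcongr))

/-- Integrates the lower bound `1 - C / x ^ 2`. The lower limit `-√h` corresponds to time `0`. -/
lemma sub_le_integral_of_tail {S : ℕ → ℝ} (hS : Antitone S) {C h X : ℝ}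
    (hC : 0 ≤ C) (hX : 1 ≤ X) (hXh : X ≤ √h)
    (htail : ∀ x ≥ 1, x ≤ √h → 1 - S (floorTime h (-x)) ≤ C / x ^ 2) :
    √h - X - C / X ≤ ∫ x in -√h..-X, S (floorTime h x) := by
  have hr : 0 < √h := by linarith
  have hne : ∀ x ∈ Set.uIcc (-√h) (-X), x < 0 := by
    intro x hx
    rw [Set.uIcc_of_le (by linarith)] at hx
    linarith [hx.2]
  have hcont : ContinuousOn (fun x : ℝ => 1 - C / x ^ 2) (Set.uIcc (-√h) (-X)) := by
    refine continuousOn_const.sub (continuousOn_const.div (by fun_prop) fun x hx => ?_)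
    exact pow_ne_zero 2 (hne x hx).ne
  have hF : ∫ x in -√h..-X, (1 - C / x ^ 2) = (-X + C / (-X)) - (-√h + C / (-√h)) := by
    refine intervalIntegral.integral_eq_sub_of_hasDerivAt (f := fun x => x + C / x)
      (fun x hx => ?_) hcont.intervalIntegrable
    have hx0 := (hne x hx).ne
    have := (hasDerivAt_id x).add ((hasDerivAt_const x C).div (hasDerivAt_id x) hx0)
    refine this.congr_deriv ?_
    simp only [id_eq, zero_mul, mul_one, zero_sub]
    ring
  have hle : ∫ x in -√h..-X, (1 - C / x ^ 2) ≤ ∫ x in -√h..-X, S (floorTime h x) := by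
    refine intervalIntegral.integral_mono_on (by linarith) hcont.intervalIntegrable
      (antitone_floorTime hS h).intervalIntegrable fun x hx => ?_
    have := htail (-x) (by linarith [hx.2]) (by linarith [hx.1])
    rw [neg_neg, neg_sq] at this
    linarith
  rw [hF, div_neg, div_neg] at hle
  have : 0 ≤ C / √h := by positivity
  linarith

/-- The expectation of a nonnegative integer variable from its tail probabilities, in rescaled
time around `h`. -/
lemma mul_integral_le_sum {S : ℕ → ℝ} (hS : Antitone S) (hS0 : ∀ t, 0 ≤ S t) {h X : ℝ}
    (hh : 0 < h) (hX : 0 ≤ X) :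
    √h * ∫ x in -√h..X, S (floorTime h x) ≤
      ∑ t ∈ Finset.range ⌈h + X * √h⌉₊, S t := by
  have hr : 0 < √h := Real.sqrt_pos.2 hh
  have hrr : √h * √h = h := Real.mul_self_sqrt hh.le
  set T := ⌈h + X * √h⌉₊ with hT
  have hanti : Antitone fun y : ℝ => S ⌊y⌋₊ := fun x y hxy => hS (Nat.floor_le_floor hxy)
  have h1 : ∫ y in (0 : ℝ)..T, S ⌊y⌋₊ ≤ ∑ t ∈ Finset.range T, S t := by
    have := AntitoneOn.integral_le_sum (x₀ := 0) (a := T) (f := fun y : ℝ => S ⌊y⌋₊)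
      (hanti.antitoneOn _)
    simpa using this
  have h2 : ∫ y in (0 : ℝ)..(h + X * √h), S ⌊y⌋₊ ≤ ∫ y in (0 : ℝ)..T, S ⌊y⌋₊ :=
    intervalIntegral.integral_mono_interval le_rfl (by positivity) (Nat.le_ceil _)
      (.of_forall fun y => hS0 _) hanti.intervalIntegrable
  have h3 := intervalIntegral.smul_integral_comp_add_mul (a := -√h) (b := X)
    (fun y : ℝ => S ⌊y⌋₊) (√h) h
  rw [smul_eq_mul] at h3
  have e1 : h + √h * -√h = 0 := by linarith
  have e2 : h + √h * X = h + X * √h := by ring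
  rw [e1, e2] at h3
  refine le_trans (le_of_eq ?_) (h2.trans h1)
  rw [← h3]
  simp only [floorTime, mul_comm]

/-- If the rescaled tail probabilities converge to a limit that exceeds the tail of a symmetric
law, then the expectations exceed `h` by a multiple of `√h`. -/
lemma exists_eventually_le_sum {S : ℝ → ℕ → ℝ} (hS : ∀ h, Antitone (S h))
    (hS0 : ∀ h t, 0 ≤ S h t) (hS1 : ∀ h t, S h t ≤ 1) {C : ℝ} (hC : 0 ≤ C)
    (htail : ∀ h ≥ 1, ∀ x ≥ 1, x ≤ √h → 1 - S h (floorTime h (-x)) ≤ C / x ^ 2)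
    {G : ℝ → ℝ} (hG : ∀ x, Tendsto (fun h => S h (floorTime h x)) atTop (𝓝 (G x)))
    (hG1 : ∀ x, 1 < G x + G (-x)) :
    ∃ c > 0, ∀ᶠ h in atTop, ∃ T : ℕ, h + c * √h ≤ ∑ t ∈ Finset.range T, S h t := by
  have hGanti : Antitone G := fun x y hxy =>
    le_of_tendsto_of_tendsto' (hG y) (hG x) fun h => antitone_floorTime (hS h) h hxy
  have hGneg : Monotone fun x => G (-x) := fun x y hxy => hGanti (neg_le_neg hxy)
  have hΔint : ∀ a b, IntervalIntegrable (fun x => G x + G (-x) - 1) volume a b := fun a b =>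
    (hGanti.intervalIntegrable.add hGneg.intervalIntegrable).sub intervalIntegrable_const
  -- A symmetric tail would have `G x + G (-x) = 1`, so `κ` measures the gain in mean. `X` is taken
  -- so large that the left tail beyond `-X` loses at most `κ / 2` of it.
  set κ := ∫ x in (0 : ℝ)..1, (G x + G (-x) - 1) with hκ
  have hκ0 : 0 < κ :=
    intervalIntegral.intervalIntegral_pos_of_pos (hΔint 0 1) (fun x => by linarith [hG1 x])
      one_pos
  set X := 1 + 2 * C / κ with hX
  have hX1 : 1 ≤ X := le_add_of_nonneg_right (by positivity)
  have hCX : C / X ≤ κ / 2 := by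
    rw [div_le_iff₀ (by linarith), hX]
    field_simp
    nlinarith
  have hGX : X + κ ≤ ∫ x in -X..X, G x := by
    have e1 : ∫ x in -X..0, G x = ∫ x in (0 : ℝ)..X, G (-x) := by
      rw [intervalIntegral.integral_comp_neg, neg_zero]
    have e2 : ∫ x in (0 : ℝ)..X, (G x + G (-x) - 1) =
        (∫ x in (0 : ℝ)..X, G x) + (∫ x in (0 : ℝ)..X, G (-x)) - X := by
      rw [intervalIntegral.integral_sub
        (hGanti.intervalIntegrable.add hGneg.intervalIntegrable) intervalIntegrable_const,
        intervalIntegral.integral_add hGanti.intervalIntegrable hGneg.intervalIntegrable]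
      simp
    have e3 : κ ≤ ∫ x in (0 : ℝ)..X, (G x + G (-x) - 1) :=
      intervalIntegral.integral_mono_interval le_rfl zero_le_one hX1
        (.of_forall fun x => by simp only [Pi.zero_apply]; linarith [hG1 x]) (hΔint _ _)
    rw [← intervalIntegral.integral_add_adjacent_intervals (b := 0)
      hGanti.intervalIntegrable hGanti.intervalIntegrable, e1]
    linarith
  have hlim : Tendsto (fun h => ∫ x in -X..X, S h (floorTime h x)) atTop
      (𝓝 (∫ x in -X..X, G x)) := by
    refine intervalIntegral.tendsto_integral_filter_of_dominated_convergence (fun _ => 1) ?_ ?_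
      intervalIntegrable_const ?_
    · exact .of_forall fun h =>
        (antitone_floorTime (hS h) h).measurable.aestronglyMeasurable
    · refine .of_forall fun h => .of_forall fun x _ => ?_
      rw [Real.norm_of_nonneg (hS0 _ _)]
      exact hS1 _ _
    · exact .of_forall fun x _ => hG x
  refine ⟨κ / 4, by positivity, ?_⟩
  filter_upwards [hlim.eventually (lt_mem_nhds (show X + 3 / 4 * κ < ∫ x in -X..X, G x by
    linarith)), eventually_ge_atTop 1, Real.tendsto_sqrt_atTop.eventually_ge_atTop X]
    with h h1 h2 h3
  refine ⟨_, le_trans ?_ (mul_integral_le_sum (hS h) (hS0 h) (h := h) (X := X) (by linarith)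
    (by linarith))⟩
  have h4 := sub_le_integral_of_tail (hS h) hC hX1 h3 (htail h h2)
  rw [← intervalIntegral.integral_add_adjacent_intervals (b := -X)
    (antitone_floorTime (hS h) h).intervalIntegrable
    (antitone_floorTime (hS h) h).intervalIntegrable]
  have hrr : √h * √h = h := Real.mul_self_sqrt (by linarith)
  have : √h * (√h + κ / 4) ≤ √h * ((∫ x in -√h..-X, S h (floorTime h x)) +
      ∫ x in -X..X, S h (floorTime h x)) :=
    mul_le_mul_of_nonneg_left (by linarith) (Real.sqrt_nonneg h)
  linarith

end HetQCD

/-! ### Expected alarm times of the rules: bounds before and after the change. -/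

namespace HetQCD

open ProbabilityTheory Topology

variable {L : ℕ} {N : Fin L → ℕ}

section AlarmSums

/-- The expected time until `M` sensors of `D` have crossed the thresholds `h`. -/
noncomputable def expectedAlarm (N : Fin L → ℕ) (α : Fin L → Measure ℝ) (M : ℕ) (h : Fin L → ℝ)
    (D : Set (Sensor N)) : ℝ≥0∞ :=
  ∑' t, sensorLaw N α {ζ | (alarmedSet h D t ζ).ncard < M}

variable {α : Fin L → Measure ℝ}

lemma expectedAlarm_mono {M M' : ℕ} (hM : M ≤ M') {h h' : Fin L → ℝ} (hh : ∀ l, h l ≤ h' l)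
    (D : Set (Sensor N)) : expectedAlarm N α M h D ≤ expectedAlarm N α M' h' D := by
  refine ENNReal.tsum_le_tsum fun t => measure_mono fun ζ hζ => ?_
  refine lt_of_le_of_lt (Set.ncard_le_ncard ?_ (Set.toFinite _)) (lt_of_lt_of_le hζ hM)
  exact fun i hi => ⟨hi.1, hi.2.anti_threshold (hh _)⟩

variable [∀ l, IsProbabilityMeasure (α l)]

lemma sensorLaw_crossed (i : Sensor N) (b : ℝ) (t : ℕ) :
    sensorLaw N α {ζ | Crossed 0 (ζ i) b t} = iid (α i.1) {z | Crossed 0 z b t} :=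
  sensorLaw_eval α i (measurableSet_crossed_seq 0 b t)

lemma sensorLaw_not_crossed (i : Sensor N) (b : ℝ) (t : ℕ) :
    sensorLaw N α {ζ | ¬ Crossed 0 (ζ i) b t} = iid (α i.1) {z | ¬ Crossed 0 z b t} :=
  sensorLaw_eval α i (measurableSet_not_crossed_seq 0 b t)

/-- Before the alarm some sensor of `S` has not crossed. Bounding a maximum of crossing times by
their sum loses a constant factor, harmless on the exponential scale. -/
lemma expectedAlarm_le_sum {M : ℕ} (h : Fin L → ℝ) {D : Set (Sensor N)} (S : Finset (Sensor N))
    (hSD : ∀ i ∈ S, i ∈ D) (hM : M ≤ S.card) :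
    expectedAlarm N α M h D ≤
      ∑ i ∈ S, ∑' t, iid (α i.1) {z | ¬ Crossed 0 z (h i.1) t} := by
  rw [← Summable.tsum_finsetSum fun i _ => ENNReal.summable]
  refine ENNReal.tsum_le_tsum fun t => ?_
  simp_rw [← sensorLaw_not_crossed]
  refine (measure_mono fun ζ hζ => ?_).trans (measure_biUnion_finset_le S _)
  by_contra hcon
  simp only [Set.mem_iUnion, Set.mem_ofPred_eq, exists_prop, not_exists, not_and, not_not] at hcon
  have h1 : (S : Set (Sensor N)) ⊆ alarmedSet h D t ζ := fun i hi => ⟨hSD i hi, hcon i hi⟩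
  have h2 := Set.ncard_le_ncard h1 (Set.toFinite _)
  rw [Set.ncard_coe_finset] at h2
  exact absurd hζ (not_lt.2 (hM.trans h2))

/-- Union bound: if an alarm was raised, then some sensor has crossed its threshold. -/
lemma one_sub_le_measureReal {M : ℕ} (hM : 1 ≤ M) (h : Fin L → ℝ) (D : Set (Sensor N))
    (S : Finset (Sensor N)) (hS : ∀ i ∈ D, i ∈ S) (t : ℕ) :
    1 - ∑ i ∈ S, (iid (α i.1)).real {z | Crossed 0 z (h i.1) t} ≤
      (sensorLaw N α).real {ζ | (alarmedSet h D t ζ).ncard < M} := by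
  have h1 := probReal_compl_eq_one_sub (μ := sensorLaw N α)
    (measurableSet_ncard_alarmedSet_lt h D t M)
  have h2 : (sensorLaw N α).real {ζ | (alarmedSet h D t ζ).ncard < M}ᶜ ≤
      ∑ i ∈ S, (sensorLaw N α).real {ζ | Crossed 0 (ζ i) (h i.1) t} := by
    refine (measureReal_mono (fun ζ hζ => ?_) (measure_ne_top _ _)).trans (measureReal_biUnion_finset_le S _)
    have h3 : 0 < (alarmedSet h D t ζ).ncard := lt_of_lt_of_le hM (not_lt.1 hζ)
    obtain ⟨i, hi⟩ := (Set.ncard_pos (Set.toFinite _)).1 h3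
    exact Set.mem_biUnion (hS i hi.1) hi.2
  simp only [measureReal_def, sensorLaw_crossed] at h1 h2 ⊢
  linarith

lemma ofReal_sum_le_expectedAlarm (M : ℕ) (h : Fin L → ℝ) (D : Set (Sensor N)) (T : ℕ) :
    ENNReal.ofReal (∑ t ∈ Finset.range T,
      (sensorLaw N α).real {ζ | (alarmedSet h D t ζ).ncard < M}) ≤ expectedAlarm N α M h D := by
  rw [ENNReal.ofReal_sum_of_nonneg fun t _ => measureReal_nonneg]
  exact (Finset.sum_congr rfl fun t _ => ofReal_measureReal).trans_le (ENNReal.sum_le_tsum _)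

lemma antitone_measureReal_ncard_lt (M : ℕ) (h : Fin L → ℝ) (D : Set (Sensor N)) :
    Antitone fun t => (sensorLaw N α).real {ζ | (alarmedSet h D t ζ).ncard < M} :=
  fun _ _ hst => measureReal_mono fun ζ hζ => lt_of_le_of_lt
    (Set.ncard_le_ncard (alarmedSet_mono_time h D hst ζ) (Set.toFinite _)) hζ

/-- Lower bound for the time to a false alarm of the first alarm rule in one group. -/
lemma exists_lt_expectedAlarm_group (hα : ∀ l, ∫⁻ x, ENNReal.ofReal (Real.exp x) ∂α l = 1)
    {I : Fin L → ℝ} {l : Fin L} (hI : 0 < I l) :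
    ∃ C : ℝ, ∀ u : ℝ, 0 ≤ u → ENNReal.ofReal (Real.exp (I l * u)) <
      expectedAlarm N α 1 (fun l => I l * (u + C)) (group N l) := by
  classical
  set n := (Fintype.card (Sensor N) : ℝ) with hn
  have hn0 : 0 ≤ n := Nat.cast_nonneg _
  refine ⟨Real.log (12 * (n + 1)) / I l, fun u hu => ?_⟩
  set C := Real.log (12 * (n + 1)) / I l with hC
  set E := Real.exp (I l * u) with hE
  have hE1 : 1 ≤ E := Real.one_le_exp (by positivity)
  have hexp : Real.exp (-(I l * (u + C))) = 1 / (12 * (n + 1) * E) := by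
    have : I l * (u + C) = I l * u + Real.log (12 * (n + 1)) := by
      rw [hC]; field_simp
    rw [this, Real.exp_neg, Real.exp_add, Real.exp_log (by positivity), one_div, mul_comm]
  set T := ⌊2 * E⌋₊ + 1 with hT
  have hT1 : 2 * E < T := by rw [hT]; push_cast; exact Nat.lt_floor_add_one _
  have hT2 : (T : ℝ) ≤ 3 * E := by
    rw [hT]; push_cast
    linarith [Nat.floor_le (show 0 ≤ 2 * E by positivity)]
  refine lt_of_lt_of_le ?_ (ofReal_sum_le_expectedAlarm 1 _ _ T)
  rw [ENNReal.ofReal_lt_ofReal_iff_of_nonneg (by positivity)]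
  have hterm : ∀ t ∈ Finset.range T, (3 / 4 : ℝ) ≤ (sensorLaw N α).real
      {ζ | (alarmedSet (fun l => I l * (u + C)) (group N l) t ζ).ncard < 1} := by
    intro t ht
    refine le_trans ?_ (one_sub_le_measureReal le_rfl _ _
      (Finset.univ.filter fun i : Sensor N => i.1 = l) 
        (fun i hi => Finset.mem_filter.2 ⟨Finset.mem_univ i, hi⟩) t)
    have h1 : ∀ i ∈ Finset.univ.filter fun i : Sensor N => i.1 = l,
        (iid (α i.1)).real {z | Crossed 0 z (I i.1 * (u + C)) t} ≤
          1 / (12 * (n + 1) * E) * (3 * E) := by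
      intro i hi
      have hil : i.1 = l := by simpa using hi
      have h2 := measure_crossed_le (hα i.1) (I i.1 * (u + C)) t 0
      have h3 : ENNReal.ofReal (Real.exp (-(I i.1 * (u + C)))) *
          (t + ENNReal.ofReal (Real.exp 0)) =
          ENNReal.ofReal (Real.exp (-(I i.1 * (u + C))) * (t + 1)) := by
        rw [ENNReal.ofReal_mul (Real.exp_pos _).le, ENNReal.ofReal_add (by positivity)
          zero_le_one, ENNReal.ofReal_natCast, Real.exp_zero]
      rw [h3] at h2
      refine (ENNReal.toReal_le_of_le_ofReal (by positivity) h2).trans ?_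
      rw [hil, hexp]
      gcongr
      have : t + 1 ≤ T := Finset.mem_range.1 ht
      have : ((t + 1 : ℕ) : ℝ) ≤ T := by exact_mod_cast this
      push_cast at this
      linarith
    have h4 := Finset.sum_le_card_nsmul _ _ _ h1
    have h5 : ((Finset.univ.filter fun i : Sensor N => i.1 = l).card : ℝ) ≤ n := by
      rw [hn]
      exact_mod_cast Finset.card_le_univ _
    rw [nsmul_eq_mul] at h4
    have h6 : (1 : ℝ) / (12 * (n + 1) * E) * (3 * E) = 1 / (4 * (n + 1)) := by
      field_simp; norm_num
    rw [h6] at h4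
    have h7 : ((Finset.univ.filter fun i : Sensor N => i.1 = l).card : ℝ) *
        (1 / (4 * (n + 1))) ≤ 1 / 4 := by
      refine (mul_le_mul_of_nonneg_right h5 (by positivity)).trans ?_
      rw [mul_one_div, div_le_div_iff₀ (by positivity) (by norm_num)]
      linarith
    linarith
  have h8 := Finset.card_nsmul_le_sum _ _ _ hterm
  rw [Finset.card_range, nsmul_eq_mul] at h8
  linarith

end AlarmSums

section Asymptotics

variable {α β : Fin L → Measure ℝ} [∀ l, IsProbabilityMeasure (α l)]
  [∀ l, IsProbabilityMeasure (β l)] {I : Fin L → ℝ}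

/-- Early alarms are unlikely under the post-change law. -/
lemma exists_one_sub_measureReal_le (H : ∀ l, IsLLRLaw (α l) (β l) (I l)) :
    ∃ C : ℝ, 0 ≤ C ∧ ∀ M ≥ 1, ∀ h ≥ 1, ∀ x ≥ 1, x ≤ √h →
      1 - (sensorLaw N β).real
        {ζ | (alarmedSet (fun l => I l * h) Set.univ (floorTime h (-x)) ζ).ncard < M} ≤
        C / x ^ 2 := by
  choose C hC0 hC using fun l => (H l).exists_measureReal_crossed_le
  refine ⟨∑ i : Sensor N, C i.1, Finset.sum_nonneg fun i _ => hC0 _,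
    fun M hM h hh x hx hxh => ?_⟩
  have h1 := one_sub_le_measureReal (α := β) hM (fun l => I l * h) Set.univ
    (Finset.univ : Finset (Sensor N)) (fun i _ => Finset.mem_univ i) (floorTime h (-x))
  have h2 : ∑ i : Sensor N,
      (iid (β i.1)).real {z | Crossed 0 z (I i.1 * h) (floorTime h (-x))} ≤
      ∑ i : Sensor N, C i.1 / x ^ 2 :=
    Finset.sum_le_sum fun i _ => hC i.1 h hh x hx hxh
  rw [← Finset.sum_div] at h2
  linarith

/-- First-order lower bound for the detection delay of the anonymous rules. -/
lemma eventually_le_expectedAlarm (H : ∀ l, IsLLRLaw (α l) (β l) (I l)) {ε : ℝ} (hε : 0 < ε)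
    (hε1 : ε < 1) :
    ∀ᶠ h : ℝ in atTop, ∀ M ≥ 1, ENNReal.ofReal ((1 - ε) * h) ≤
      expectedAlarm N β M (fun l => I l * h) Set.univ := by
  obtain ⟨C, hC0, hC⟩ := exists_one_sub_measureReal_le (N := N) H
  set X := 1 + 2 * C / ε with hX
  have hX1 : 1 ≤ X := le_add_of_nonneg_right (by positivity)
  have hCX : C / X ^ 2 ≤ ε / 2 := by
    have h1 : X ≤ X ^ 2 := by nlinarith
    have h2 : C ≤ ε / 2 * X := by rw [hX]; field_simp; nlinarith
    rw [div_le_iff₀ (by positivity)]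
    nlinarith
  filter_upwards [eventually_ge_atTop 1, Real.tendsto_sqrt_atTop.eventually_ge_atTop X,
    Real.tendsto_sqrt_atTop.eventually_ge_atTop (2 * X / ε)] with h h1 h2 h3 M hM
  set T := floorTime h (-X) with hT
  refine le_trans (ENNReal.ofReal_le_ofReal ?_) (ofReal_sum_le_expectedAlarm M _ _ (T + 1))
  have h4 := hC M hM h h1 X hX1 h2
  have h5 : ∀ t ∈ Finset.range (T + 1), 1 - ε / 2 ≤ (sensorLaw N β).real
      {ζ | (alarmedSet (fun l => I l * h) Set.univ t ζ).ncard < M} := by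
    intro t ht
    have := antitone_measureReal_ncard_lt (α := β) M (fun l => I l * h)
      (Set.univ : Set (Sensor N)) (Nat.lt_succ_iff.1 (Finset.mem_range.1 ht))
    simp only at this
    linarith
  have h6 := Finset.card_nsmul_le_sum _ _ _ h5
  rw [Finset.card_range, nsmul_eq_mul] at h6
  refine le_trans ?_ h6
  have h7 : h - X * √h < (T + 1 : ℕ) := by
    have := Nat.lt_floor_add_one (h + -X * √h)
    rw [hT, floorTime]
    push_cast
    linarith
  have h8 : X * √h ≤ ε / 2 * h := by
    rw [div_le_iff₀ hε] at h3
    have hrr : √h * √h = h := Real.mul_self_sqrt (by linarith)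
    have := mul_le_mul_of_nonneg_right h3 (Real.sqrt_nonneg h)
    nlinarith
  have h9 : (1 - ε / 2) * h ≤ (T + 1 : ℕ) := by linarith
  calc (1 - ε) * h ≤ (1 - ε / 2) * h * (1 - ε / 2) := by
        have : 0 ≤ ε ^ 2 / 4 * h := by positivity
        nlinarith
    _ ≤ _ := by
        gcongr
        linarith

/-- Second-order lower bound for the detection delay of the late anonymous rules. -/
lemma exists_eventually_le_expectedAlarm (H : ∀ l, IsLLRLaw (α l) (β l) (I l)) {k : ℕ}
    (hk : k ≤ Fintype.card (Sensor N)) (hk2 : Fintype.card (Sensor N) < 2 * k + 1) :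
    ∃ c > 0, ∀ᶠ h : ℝ in atTop, ENNReal.ofReal (h + c * √h) ≤
      expectedAlarm N β (k + 1) (fun l => I l * h) Set.univ := by
  classical
  obtain ⟨C, hC0, hC⟩ := exists_one_sub_measureReal_le (N := N) H
  set v : Fin L → NNReal := fun l => (variance (fun x => x) (β l)).toNNReal with hv
  have hv0 : ∀ l, v l ≠ 0 := fun l => (H l).variance_ne_zero
  -- Limiting crossing probabilities at time `h + x * √h`; Gaussian symmetry makes `x ↦ -x` act as
  -- `p ↦ 1 - p`.
  set p : ℝ → Sensor N → ℝ := fun x i => gaussTail (v i.1) (-(I i.1 * x)) with hp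
  have hpneg : ∀ x, p (-x) = fun i => 1 - p x i := by
    intro x
    funext i
    simp only [hp]
    rw [mul_neg, ← gaussTail_neg (hv0 _)]
  have key := exists_eventually_le_sum
    (S := fun h t => (sensorLaw N β).real
      {ζ | (alarmedSet (fun l => I l * h) Set.univ t ζ).ncard < k + 1})
    (fun h => antitone_measureReal_ncard_lt _ _ _) (fun h t => measureReal_nonneg)
    (fun h t => measureReal_le_one) hC0 (hC (k + 1) (by omega))
    (G := fun x => probFewer (p x) (k + 1)) (fun x => ?_) (fun x => ?_)
  · obtain ⟨c, hc, hev⟩ := key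
    refine ⟨c, hc, ?_⟩
    filter_upwards [hev] with h ⟨T, hT⟩
    exact (ENNReal.ofReal_le_ofReal hT).trans (ofReal_sum_le_expectedAlarm _ _ _ T)
  · have e : ∀ h : ℝ, (sensorLaw N β).real
        {ζ | (alarmedSet (fun l => I l * h) Set.univ (floorTime h x) ζ).ncard < k + 1} =
        probFewer (fun i : Sensor N =>
          (iid (β i.1)).real {z | Crossed 0 z (I i.1 * h) (floorTime h x)}) (k + 1) := by
      intro h
      rw [← measureReal_infinitePi_ncard_lt (fun i : Sensor N => iid (β i.1))
        (fun i => measurableSet_crossed_seq 0 (I i.1 * h) (floorTime h x))]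
      simp only [alarmedSet, Set.mem_univ, true_and, Set.mem_ofPred_eq]
      rfl
    simp_rw [e]
    exact ((continuous_probFewer (k + 1)).tendsto (p x)).comp
      (tendsto_pi_nhds.2 fun i => (H i.1).tendsto_measureReal_crossed x)
  · rw [hpneg]
    exact one_lt_probFewer_add (fun i => gaussTail_pos (hv0 _) _)
      (fun i => gaussTail_lt_one (hv0 _) _) hk hk2

/-- Upper bound for the time to a false alarm. -/
lemma eventually_expectedAlarm_lt (H : ∀ l, IsLLRLaw (α l) (β l) (I l)) {δ : ℝ} (hδ : 0 < δ) :
    ∀ᶠ h : ℝ in atTop, ∀ (S : Finset (Sensor N)) (M : ℕ) (y : ℝ), M ≤ S.card →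
      (∀ i ∈ S, Real.log (Fintype.card (Sensor N) + 1) + I i.1 * (h + δ * √h) ≤ y) →
      expectedAlarm N α M (fun l => I l * h) Set.univ < ENNReal.ofReal (Real.exp y) := by
  have h1 : ∀ᶠ h : ℝ in atTop, ∀ l, ∑' t, iid (α l) {z | ¬ Crossed 0 z (I l * h) t} ≤
      ENNReal.ofReal (Real.exp (I l * (h + δ * √h))) :=
    eventually_all.2 fun l => (H l).eventually_tsum_not_crossed_le_exp hδ
  filter_upwards [h1] with h h1 S M y hM hy
  set n := (Fintype.card (Sensor N) : ℝ) with hn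
  have hn0 : 0 ≤ n := Nat.cast_nonneg _
  have h2 : expectedAlarm N α M (fun l => I l * h) Set.univ ≤
      ∑ i ∈ S, ENNReal.ofReal (Real.exp y / (n + 1)) := by
    refine (expectedAlarm_le_sum _ S (fun i _ => trivial) hM).trans
      (Finset.sum_le_sum fun i hi => (h1 i.1).trans (ENNReal.ofReal_le_ofReal ?_))
    have := Real.exp_le_exp.2 (hy i hi)
    rw [Real.exp_add, Real.exp_log (by positivity)] at this
    rw [le_div_iff₀ (by positivity)]
    linarith
  refine h2.trans_lt ?_
  rw [Finset.sum_const, nsmul_eq_mul, ← ENNReal.ofReal_natCast,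
    ← ENNReal.ofReal_mul (Nat.cast_nonneg _),
    ENNReal.ofReal_lt_ofReal_iff (Real.exp_pos _), mul_div_assoc', div_lt_iff₀ (by positivity),
    mul_comm]
  have : (S.card : ℝ) ≤ n := by
    rw [hn]
    exact_mod_cast Finset.card_le_univ S
  exact mul_lt_mul_of_pos_left (by linarith) (Real.exp_pos _)

end Asymptotics

/-- The laws of the log-likelihood ratio. -/
lemma isLLRLaw_map_llr {𝒳 : Type*} [MeasurableSpace 𝒳] {f g : Measure 𝒳}
    [IsProbabilityMeasure f] [IsProbabilityMeasure g] (hfg : f ≪ g) (hgf : g ≪ f)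
    (hpos : 0 < (InformationTheory.klDiv g f).toReal)
    (hσ : MemLp (fun x => llr g f x - (InformationTheory.klDiv g f).toReal) 2 g) :
    IsLLRLaw (f.map (llr g f)) (g.map (llr g f)) (InformationTheory.klDiv g f).toReal := by
  have hm := measurable_llr g f
  refine ⟨?_, ?_, ?_, hpos⟩
  · refine Measure.ext fun s hs => ?_
    rw [Measure.map_apply hm hs, withDensity_apply _ hs, setLIntegral_map hs (by fun_prop) hm,
      ← Measure.setLIntegral_rnDeriv hgf]
    refine setLIntegral_congr_fun_ae (hm hs) ?_
    filter_upwards [exp_llr_of_ac' g f hfg, Measure.rnDeriv_lt_top g f] with x h1 h2 _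
    rw [h1, ENNReal.ofReal_toReal h2.ne]
  · refine (memLp_map_measure_iff (by fun_prop) hm.aemeasurable).2 ?_
    have := hσ.add (memLp_const (InformationTheory.klDiv g f).toReal)
    refine this.ae_eq (.of_forall fun x => ?_)
    simp
  · rw [integral_map hm.aemeasurable (by fun_prop),
      InformationTheory.toReal_klDiv_of_measure_eq hgf (by simp)]

end HetQCD

/-! ### Comparison of the rules at equal run length. -/

namespace HetQCD

open ProbabilityTheory Topology

section Comparison

variable {L : ℕ} {N : Fin L → ℕ}

lemma card_filter_group (l : Fin L) :
    (Finset.univ.filter fun i : Sensor N => i.1 = l).card = N l := by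
  have : (Finset.univ.filter fun i : Sensor N => i.1 = l) =
      Finset.univ.map (Function.Embedding.sigmaMk l) := by
    ext ⟨j, k⟩
    simp only [Finset.mem_filter, Finset.mem_univ, true_and, Finset.mem_map,
      Function.Embedding.sigmaMk_apply]
    constructor
    · rintro rfl
      exact ⟨k, rfl⟩
    · rintro ⟨k', hk'⟩
      exact (congrArg Sigma.fst hk').symm
  rw [this, Finset.card_map, Finset.card_univ, Fintype.card_fin]

variable {α β : Fin L → Measure ℝ} [∀ l, IsProbabilityMeasure (β l)] {I : Fin L → ℝ}

/-- Upper bound for the detection delay of the first alarm rule in one group. -/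
lemma eventually_expectedAlarm_group_le (H : ∀ l, IsLLRLaw (α l) (β l) (I l)) {l : Fin L}
    (hl : 0 < N l) (C : ℝ) {ε : ℝ} (hε : 0 < ε) :
    ∀ᶠ u : ℝ in atTop, expectedAlarm N β 1 (fun l => I l * (u + C)) (group N l) ≤
      ENNReal.ofReal (u + ε * √u) := by
  have h1 := (tendsto_atTop_add_const_right atTop C tendsto_id).eventually
    ((H l).eventually_tsum_not_crossed_le (show 0 < ε / 4 by positivity))
  filter_upwards [h1, eventually_ge_atTop |C|,
    Real.tendsto_sqrt_atTop.eventually_ge_atTop (2 * |C| / ε)] with u h1 h2 h3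
  have hu : 0 ≤ u := (abs_nonneg C).trans h2
  refine (expectedAlarm_le_sum _ {(⟨l, ⟨0, hl⟩⟩ : Sensor N)} (fun i hi => ?_) (by simp)).trans ?_
  · rw [Finset.mem_singleton] at hi
    subst hi
    rfl
  rw [Finset.sum_singleton]
  refine h1.trans (ENNReal.ofReal_le_ofReal ?_)
  simp only [id]
  have h4 : √(u + C) ≤ 2 * √u := by
    rw [show 2 * √u = √(2 ^ 2 * u) by
      rw [Real.sqrt_mul (by norm_num), Real.sqrt_sq (by norm_num)]]
    exact Real.sqrt_le_sqrt (by linarith [le_abs_self C])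
  have h5 : C ≤ ε / 2 * √u := by
    rw [div_le_iff₀ hε] at h3
    linarith [le_abs_self C]
  have h6 : ε / 4 * √(u + C) ≤ ε / 4 * (2 * √u) := by gcongr
  linarith

variable [∀ l, IsProbabilityMeasure (α l)]

/-- The rules that wait for few sensors are worse to first order. -/
lemma eventually_lt_expectedAlarm_of_le (H : ∀ l, IsLLRLaw (α l) (β l) (I l)) {lmax : Fin L}
    (hmax : ∀ l, l ≠ lmax → I l < I lmax) :
    ∀ᶠ u : ℝ in atTop, ∀ M ≥ 1, M ≤ Fintype.card (Sensor N) - N lmax → ∀ h : ℝ,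
      ENNReal.ofReal (Real.exp (I lmax * u)) ≤
        expectedAlarm N α M (fun l => I l * h) Set.univ →
      ENNReal.ofReal (u + √u) < expectedAlarm N β M (fun l => I l * h) Set.univ := by
  have hI : ∀ l, 0 < I l := fun l => (H l).pos
  obtain ⟨η, hη, hη1⟩ : ∃ η : ℝ, (∀ l, l ≠ lmax → I l * η < I lmax) ∧ 1 < η := by
    have h1 : ∀ᶠ η : ℝ in 𝓝[>] 1, ∀ l, l ≠ lmax → I l * η < I lmax := by
      refine eventually_all.2 fun l => ?_
      by_cases hl : l = lmax
      · simp [hl]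
      · have : Tendsto (fun η : ℝ => I l * η) (𝓝[>] 1) (𝓝 (I l * 1)) :=
          ((continuous_const_mul (I l)).tendsto 1).mono_left nhdsWithin_le_nhds
        filter_upwards [this.eventually (gt_mem_nhds (by rw [mul_one]; exact hmax l hl))] with η hη _
        exact hη
    exact (h1.and self_mem_nhdsWithin).exists
  have hηt : Tendsto (fun u : ℝ => η * u) atTop atTop := tendsto_id.const_mul_atTop (by linarith)
  -- Makes `(1 - ε) * η = (η + 1) / 2 > 1`, leaving a linear gain over `u + √u`.
  set ε := (η - 1) / (2 * η) with hε
  have hε0 : 0 < ε := div_pos (by linarith) (by linarith)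
  have hε1 : ε < 1 := by rw [hε, div_lt_one (by linarith)]; linarith
  have hεη : (1 - ε) * η = (η + 1) / 2 := by rw [hε]; field_simp; ring
  have h1 := hηt.eventually (eventually_expectedAlarm_lt (N := N) H one_pos)
  have h2 := hηt.eventually (eventually_le_expectedAlarm (N := N) H hε0 hε1)
  have h3 : ∀ᶠ u : ℝ in atTop, ∀ l, l ≠ lmax →
      Real.log (Fintype.card (Sensor N) + 1) + I l * (η * u + 1 * √(η * u)) ≤ I lmax * u := by
    refine eventually_all.2 fun l => ?_
    by_cases hl : l = lmax
    · simp [hl]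
    set d := I lmax - I l * η with hd
    have hd0 : 0 < d := sub_pos.2 (hη l hl)
    filter_upwards [eventually_gt_atTop 0,
      eventually_ge_atTop (2 * Real.log (Fintype.card (Sensor N) + 1) / d),
      Real.tendsto_sqrt_atTop.eventually_ge_atTop (2 * I l * √η / d)] with u h4 h5 h6 _
    rw [div_le_iff₀ hd0] at h5 h6
    rw [Real.sqrt_mul (by linarith)]
    have hrr : √u * √u = u := Real.mul_self_sqrt h4.le
    have := mul_le_mul_of_nonneg_right h6 (Real.sqrt_nonneg u)
    nlinarith
  filter_upwards [h1, h2, h3, eventually_gt_atTop 0,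
    Real.tendsto_sqrt_atTop.eventually_gt_atTop (2 / (η - 1))]
    with u h1 h2 h3 h4 h5 M hM hMk h hARL
  -- Otherwise the sensors outside the most informative group, at least `M` in number, would give a
  -- run length that is too short.
  have hηh : η * u < h := by
    by_contra! hle
    refine absurd (hARL.trans (expectedAlarm_mono (α := α) le_rfl (h' := fun l => I l * (η * u))
      (fun l => mul_le_mul_of_nonneg_left hle (hI l).le) _)) (not_le.2 ?_)
    refine h1 (Finset.univ.filter fun i : Sensor N => ¬ i.1 = lmax) M _ ?_ fun i hi =>
      h3 i.1 (Finset.mem_filter.1 hi).2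
    have := Finset.card_filter_add_card_filter_not (s := (Finset.univ : Finset (Sensor N)))
      (fun i => i.1 = lmax)
    rw [card_filter_group, Finset.card_univ] at this
    omega
  refine lt_of_lt_of_le ?_ ((h2 M hM).trans (expectedAlarm_mono (α := β) le_rfl
    (fun l => mul_le_mul_of_nonneg_left hηh.le (hI l).le) _))
  rw [ENNReal.ofReal_lt_ofReal_iff_of_nonneg (by positivity), ← mul_assoc, hεη]
  have hr : 0 < √u := Real.sqrt_pos.2 h4
  have hrr : √u * √u = u := Real.mul_self_sqrt h4.le
  rw [div_lt_iff₀ (by linarith)] at h5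
  have := mul_lt_mul_of_pos_right h5 hr
  nlinarith

/-- The rules that wait for many sensors are worse to second order. -/
lemma exists_eventually_lt_expectedAlarm_of_lt (H : ∀ l, IsLLRLaw (α l) (β l) (I l))
    {lmax : Fin L} (hmax : ∀ l, l ≠ lmax → I l < I lmax)
    (hhalf : 2 * N lmax < Fintype.card (Sensor N)) :
    ∃ c > 0, ∀ᶠ u : ℝ in atTop, ∀ M ≤ Fintype.card (Sensor N),
      Fintype.card (Sensor N) - N lmax < M → ∀ h : ℝ,
      ENNReal.ofReal (Real.exp (I lmax * u)) ≤
        expectedAlarm N α M (fun l => I l * h) Set.univ →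
      ENNReal.ofReal (u + c * √u) < expectedAlarm N β M (fun l => I l * h) Set.univ := by
  have hI : ∀ l, 0 < I l := fun l => (H l).pos
  have hmax' : ∀ l, I l ≤ I lmax := fun l => by
    by_cases hl : l = lmax
    · rw [hl]
    · exact (hmax l hl).le
  obtain ⟨c, hc, hev⟩ := exists_eventually_le_expectedAlarm (N := N) H
    (k := Fintype.card (Sensor N) - N lmax) (by omega) (by omega)
  -- At `v = u - c / 8 * √u` with slack `c / 16` the run length is still too short, so `h > v`; the
  -- delay is then at least `v + c * √v ≥ u + 3 / 8 * c * √u`, using `√v ≥ √u / 2`.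
  have hvt := tendsto_add_mul_sqrt_atTop (-(c / 8))
  have h1 := hvt.eventually (eventually_expectedAlarm_lt (N := N) H (show 0 < c / 16 by positivity))
  refine ⟨c / 4, by positivity, ?_⟩
  filter_upwards [h1, hvt.eventually hev, eventually_gt_atTop 0,
    Real.tendsto_sqrt_atTop.eventually_ge_atTop c,
    Real.tendsto_sqrt_atTop.eventually_ge_atTop
      (16 * Real.log (Fintype.card (Sensor N) + 1) / (c * I lmax))]
    with u h1 h2 hu h4 h5 M hM hMk h hARL
  have hr : 0 < √u := Real.sqrt_pos.2 hu
  have hrr : √u * √u = u := Real.mul_self_sqrt hu.le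
  set v := u + -(c / 8) * √u with hv
  have hvu : v ≤ u := by rw [hv]; nlinarith
  have hvu4 : u / 4 ≤ v := by rw [hv]; nlinarith
  have hv0 : 0 ≤ v := le_trans (by positivity) hvu4
  have hsv : √v ≤ √u := Real.sqrt_le_sqrt hvu
  have hsv' : √u / 2 ≤ √v := by
    rw [show √u / 2 = √(u / 2 ^ 2) by
      rw [Real.sqrt_div hu.le, Real.sqrt_sq (by norm_num)]]
    exact Real.sqrt_le_sqrt (by linarith)
  have hvh : v < h := by
    by_contra! hle
    refine absurd (hARL.trans (expectedAlarm_mono (α := α) hM (h' := fun l => I l * v)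
      (fun l => mul_le_mul_of_nonneg_left hle (hI l).le) _)) (not_le.2 ?_)
    refine h1 Finset.univ _ _ (by rw [Finset.card_univ]) fun i _ => ?_
    rw [div_le_iff₀ (mul_pos hc (hI _))] at h5
    have h6 : I i.1 * (v + c / 16 * √v) ≤ I lmax * (v + c / 16 * √u) :=
      mul_le_mul (hmax' _) (by gcongr) (by positivity) (hI lmax).le
    have h7 : I lmax * (v + c / 16 * √u) = I lmax * u - √u * (c * I lmax) / 16 := by
      rw [hv]; ring
    linarith
  refine lt_of_lt_of_le ?_ (h2.trans (expectedAlarm_mono (α := β) hMk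
    (fun l => mul_le_mul_of_nonneg_left hvh.le (hI l).le) _))
  rw [ENNReal.ofReal_lt_ofReal_iff_of_nonneg (by positivity)]
  have : c * (√u / 2) ≤ c * √v := by gcongr
  have hcr : 0 < c * √u := mul_pos hc hr
  rw [hv]
  linarith

/-- Comparison of the first alarm rule of the most informative group with the anonymous rules. -/
lemma exists_eventually_expectedAlarm_lt (H : ∀ l, IsLLRLaw (α l) (β l) (I l)) {lmax : Fin L}
    (hN : 0 < N lmax) (hmax : ∀ l, l ≠ lmax → I l < I lmax)
    (hhalf : 2 * N lmax < Fintype.card (Sensor N)) :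
    ∃ C : ℝ, ∀ᶠ u : ℝ in atTop,
      ENNReal.ofReal (Real.exp (I lmax * u)) <
        expectedAlarm N α 1 (fun l => I l * (u + C)) (group N lmax) ∧
      ∀ M ∈ Finset.Icc 1 (Fintype.card (Sensor N)), ∀ h : ℝ,
        ENNReal.ofReal (Real.exp (I lmax * u)) ≤
          expectedAlarm N α M (fun l => I l * h) Set.univ →
        expectedAlarm N β 1 (fun l => I l * (u + C)) (group N lmax) <
          expectedAlarm N β M (fun l => I l * h) Set.univ := by
  obtain ⟨C, hC⟩ := exists_lt_expectedAlarm_group (N := N) (fun l => (H l).tilt.lintegral_exp)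
    (H lmax).pos
  obtain ⟨c, hc, hev⟩ := exists_eventually_lt_expectedAlarm_of_lt H hmax hhalf
  refine ⟨C, ?_⟩
  filter_upwards [eventually_ge_atTop 0, hev, eventually_lt_expectedAlarm_of_le (N := N) H hmax,
    eventually_expectedAlarm_group_le H hN C hc,
    eventually_expectedAlarm_group_le H hN C one_pos] with u hu h1 h2 h3 h4
  refine ⟨hC u hu, fun M hM h hARL => ?_⟩
  rw [Finset.mem_Icc] at hM
  rcases le_or_gt M (Fintype.card (Sensor N) - N lmax) with hMk | hMk
  · rw [one_mul] at h4
    exact h4.trans_lt (h2 M hM.1 hMk h hARL)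
  · exact h3.trans_lt (h1 M hM.2 hMk h hARL)

end Comparison

end HetQCD

theorem corollary3 {L : ℕ} {𝒳 : Fin L → Type*} [∀ l, MeasurableSpace (𝒳 l)]
    (N : Fin L → ℕ) (hN : ∀ l, 0 < N l)
    (f g : ∀ l, Measure (𝒳 l))
    [∀ l, IsProbabilityMeasure (f l)] [∀ l, IsProbabilityMeasure (g l)]
    (hfg : ∀ l, f l ≪ g l) (hgf : ∀ l, g l ≪ f l)
    (hKL : ∀ l, 0 < HetQCD.KL f g l)
    (hσ : ∀ l, MemLp (fun x => llr (g l) (f l) x - HetQCD.KL f g l) 2 (g l))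
    (lmax : Fin L) (hmax : ∀ l, l ≠ lmax → HetQCD.KL f g l < HetQCD.KL f g lmax)
    (hhalf : (N lmax : ℝ) < ((∑ l, N l : ℕ) : ℝ) / 2) :
    ∀ᶠ γ : ℝ in atTop,
      (∃ h' : ℝ,
        ENNReal.ofReal γ < HetQCD.ARL f g (HetQCD.alarmWithin f g 1
          (fun l => HetQCD.KL f g l * h') (HetQCD.group N lmax)) ∧
        ∀ M ∈ Finset.Icc 1 (∑ l, N l), ∀ h : ℝ,
          ENNReal.ofReal γ ≤
            HetQCD.ARL f g (HetQCD.alarm N f g M (fun l => HetQCD.KL f g l * h)) →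
          HetQCD.EDD f g (HetQCD.alarmWithin f g 1
              (fun l => HetQCD.KL f g l * h') (HetQCD.group N lmax)) <
            HetQCD.EDD f g (HetQCD.alarm N f g M (fun l => HetQCD.KL f g l * h))) ∧
      (∀ M ∈ Finset.Icc 1 (∑ l, N l), ∀ h' h : ℝ,
        HetQCD.ARL f g (HetQCD.alarmWithin f g 1
            (fun l => HetQCD.KL f g l * h') (HetQCD.group N lmax)) = ENNReal.ofReal γ →
        HetQCD.ARL f g (HetQCD.alarm N f g M (fun l => HetQCD.KL f g l * h)) =
          ENNReal.ofReal γ →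
        HetQCD.EDD f g (HetQCD.alarmWithin f g 1
            (fun l => HetQCD.KL f g l * h') (HetQCD.group N lmax)) <
          HetQCD.EDD f g (HetQCD.alarm N f g M (fun l => HetQCD.KL f g l * h))) := by
  have hα : ∀ l, IsProbabilityMeasure ((f l).map (llr (g l) (f l))) := fun l =>
    Measure.isProbabilityMeasure_map (measurable_llr _ _).aemeasurable
  have hβ : ∀ l, IsProbabilityMeasure ((g l).map (llr (g l) (f l))) := fun l =>
    Measure.isProbabilityMeasure_map (measurable_llr _ _).aemeasurable
  have H : ∀ l, HetQCD.IsLLRLaw ((f l).map (llr (g l) (f l))) ((g l).map (llr (g l) (f l)))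
      (HetQCD.KL f g l) := fun l => HetQCD.isLLRLaw_map_llr (hfg l) (hgf l) (hKL l) (hσ l)
  have hcard : Fintype.card (HetQCD.Sensor N) = ∑ l, N l := by simp
  have hhalf' : 2 * N lmax < Fintype.card (HetQCD.Sensor N) := by
    rw [hcard]
    have : (2 * N lmax : ℝ) < (∑ l, N l : ℕ) := by linarith
    exact_mod_cast this
  obtain ⟨C, hC⟩ := HetQCD.exists_eventually_expectedAlarm_lt H (hN lmax) hmax hhalf'
  have hlog : Tendsto (fun γ : ℝ => Real.log γ / HetQCD.KL f g lmax) atTop atTop :=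
    Real.tendsto_log_atTop.atTop_div_const (hKL lmax)
  filter_upwards [hlog.eventually hC, eventually_gt_atTop 0] with γ hγ hγ0
  set u := Real.log γ / HetQCD.KL f g lmax
  have hexp : Real.exp (HetQCD.KL f g lmax * u) = γ := by
    rw [mul_div_cancel₀ _ (hKL lmax).ne', Real.exp_log hγ0]
  rw [hexp, hcard] at hγ
  have hARL : ∀ M h D, HetQCD.ARL f g (HetQCD.alarmWithin f g M h D) =
      HetQCD.expectedAlarm N (fun l => (f l).map (llr (g l) (f l))) M h D := HetQCD.ARL_alarmWithin f g
  have hEDD : ∀ M h D, HetQCD.EDD f g (HetQCD.alarmWithin f g M h D) =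
      HetQCD.expectedAlarm N (fun l => (g l).map (llr (g l) (f l))) M h D := HetQCD.EDD_alarmWithin f g
  simp only [HetQCD.alarm, hARL, hEDD]
  refine ⟨⟨u + C, hγ.1, hγ.2⟩, fun M hM h' h h1 h2 => ?_⟩
  -- The parameter `u + C` already gives a run length above `γ`, so run length exactly `γ` forces
  -- `h' ≤ u + C` by monotonicity, and the delay is no larger than in the first claim.
  refine lt_of_le_of_lt (HetQCD.expectedAlarm_mono le_rfl (fun l => ?_) _) (hγ.2 M hM h h2.ge)
  refine mul_le_mul_of_nonneg_left ?_ (hKL l).le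
  by_contra! hlt
  refine (hγ.1.trans_le (HetQCD.expectedAlarm_mono le_rfl (fun l => ?_) _)).ne' h1
  exact mul_le_mul_of_nonneg_left hlt.le (hKL l).le
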